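/- **Setting.** Let $X$ (problems) and $Y$ (chains) be measurable spaces and $U:X\times Y\to[0,1]$ a measurable utility. Let $\mathcal H$ be a nonempty class of measurable reward functions $r:X\times Y\to[-B,B]$ that is pointwise separable (some countable $\mathcal H_0\subseteq\mathcal H$ contains, for every $r\in\mathcal H$, a sequence converging to $r$ pointwise; this is automatic if $X\times Y$ is countable). Its VC-dimension is the VC-dimension of the class of subgraphs $\{(z,t)\in (X\times Y)\times\mathbb R: t<r(z)\}$, $r\in\mathcal H$. For $n$ problems with $K$ chains each, one observes the $nK$ labelled examples $(z_{ik},U(z_{ik}))$, where $z_{ik}=(x_{ik},y_{ik})\in X\times Y$, $1\le i\le n$, $1\le k\le K$, are independent with laws $D_{ik}$. (This includes $n$ given problems $x_i$ with independently generated chains $y_{ik}$, where $D_{ik}=\delta_{x_i}\otimes\nu_{ik}$, as well as i.i.d. examples, where all $D_{ik}=D$.) A *loss* is a continuous $\ell:\mathbb R\times\mathbb R\to\mathbb R$ such that $v\mapsto\ell(v,u)$ is $\Lambda$-Lipschitz on $[-B,B]$ for every $u\in[0,1]$. Put $$\widehat L(r)=\frac1{nK}\sum_{i,k}\ell(r(z_{ik}),U(z_{ik})),\qquad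 L(r)=\frac1{nK}\sum_{i,k}\mathbb E_{z\sim D_{ik}}\,\ell(r(z),U(z)).$$ Given a reference policy $\pi_{\rm ref}$ (a Markov kernel from $X$ to $Y$), $\beta>0$ and probability measures $\mu_{ik}$ on $X$, the policy induced by $r$ is $\pi_r(dy\mid x)\propto e^{r(x,y)/\beta}\,\pi_{\rm ref}(dy\mid x)$, with expected utility $$V(r)=\frac1{nK}\sum_{i,k}\mathbb E_{x\sim\mu_{ik}}\mathbb E_{y\sim\pi_r(\cdot\mid x)}U(x,y).$$ **Theorem.** For all $\delta>0$, $\beta>0$, $B$ and $\Lambda\ge 0$ there is a constant $C>0$, depending on nothing else, such that for all integers $N,K\ge1$, $d\ge0$ and all $\varepsilon>0$ there is an integer $n_0\ge N$ with $$n_0K\;\le\; C\Bigl(NK+\frac d{\varepsilon^2}\Bigr),\qquad\text{and } n_0=N \text{ if } NK\ge C\,\frac{d}{\varepsilon^2},$$ for which the following holds for every $n\ge n_0$, all $X,Y$, and every class $\mathcal H$ as above of VC-dimension at most $d$, when the $nK$ utilities are observed. 1. (Ranking.) Let $U$ and the $D_{ik}$ be as above. If $D_{ik}(U=t)=0$ for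 all $i,k$ and all $t\in\mathbb R$, then almost surely, for every problem $i$, there is exactly one ranking of its $K$ chains by strictly decreasing utility, and it is the one obtained by sorting the $K$ observed utilities. 2. (Learning the reward by empirical risk minimization.) Let $\ell$ be a loss. Some $\hat r\in\mathcal H$ satisfies $\widehat L(\hat r)\le \widehat L(r)+\varepsilon/2$ for all $r\in\mathcal H$ (and likewise for any data set of $nK$ examples with real labels). For all $U$ and $D_{ik}$ as above, with probability at least $1-\delta$, every such $\hat r$ satisfies $L(\hat r)\le L(r)+\varepsilon$ for all $r\in\mathcal H$. 3. (Expected utility of the induced policy.) For every $\pi_{\rm ref}$ there is a learner, a map from data sets of $nK$ labelled examples to $\mathcal H$, such that for all $U$ as above and all $\mu_{ik}$, if $D_{ik}$ is the law of $(x,y)$ with $x\sim\mu_{ik}$ and $y\sim\pi_{\rm ref}(\cdot\mid x)$, then with probability at least $1-\delta$ the learned reward $\hat r$ satisfies $V(\hat r)\ge V(r)-\varepsilon$ for all $r\in\mathcal H$. In 2 and 3 the probability of failure is to be read as an outer probability. -/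

import Mathlib

open MeasureTheory ProbabilityTheory Filter Topology Set
open scoped NNReal ENNReal

universe u v

noncomputable section

/-- The class `𝒞` of subsets of `α` shatters the finite set `s`: every subset of `s` is cut out
of `s` by a member of `𝒞`. -/
def ShattersFinset {α : Type*} (𝒞 : Set (Set α)) (s : Finset α) : Prop :=
  ∀ t ⊆ s, ∃ c ∈ 𝒞, ∀ a ∈ s, a ∈ c ↔ a ∈ t

/-- The Vapnik-Chervonenkis dimension of a class of sets: the supremum of the cardinalities of the
finite sets that it shatters (`⊤` if these are unbounded). -/
def vcDimension {α : Type*} (𝒞 : Set (Set α)) : ℕ∞ :=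
  ⨆ s : Finset α, ⨆ _ : ShattersFinset 𝒞 s, (s.card : ℕ∞)

/-- The (strict) subgraph of a real-valued function. -/
def subgraph {Z : Type*} (r : Z → ℝ) : Set (Z × ℝ) := {p | p.2 < r p.1}

/-- The VC-dimension of a class of real-valued functions, i.e. the VC-dimension of the class of
their subgraphs (also called the pseudo-dimension). -/
def rewardVCDim {Z : Type*} (H : Set (Z → ℝ)) : ℕ∞ := vcDimension (subgraph '' H)

/-- A class of reward functions: nonempty, made of measurable functions with values in `[-B, B]`,
and pointwise separable (every member is the pointwise limit of a sequence from one fixed countable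
subclass). Pointwise separability is the usual measurability condition of empirical process
theory; it is automatic when `Z` is countable. -/
structure IsRewardClass {Z : Type*} [MeasurableSpace Z] (B : ℝ) (H : Set (Z → ℝ)) : Prop where
  nonempty : H.Nonempty
  measurable : ∀ r ∈ H, Measurable r
  bounded : ∀ r ∈ H, ∀ z, |r z| ≤ B
  separable : ∃ H₀ : Set (Z → ℝ), H₀ ⊆ H ∧ H₀.Countable ∧
    ∀ r ∈ H, ∃ s : ℕ → Z → ℝ, (∀ t, s t ∈ H₀) ∧ ∀ z, Tendsto (fun t => s t z) atTop (𝓝 (r z))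

/-- The data set that is observed: every sampled problem-chain pair together with its utility. -/
def observe {ι Z : Type*} (U : Z → ℝ) (z : ι → Z) : ι → Z × ℝ := fun j => (z j, U (z j))

/-- `σ` is the ranking of the `K` chains of one problem with utilities `u`: the chains
`σ 0, σ 1, …` have strictly decreasing utility. -/
def IsRanking {K : ℕ} (u : Fin K → ℝ) (σ : Equiv.Perm (Fin K)) : Prop :=
  StrictAnti fun k => u (σ k)

/-- The permutation obtained by sorting observed utilities in decreasing order. -/
def sortUtilities {K : ℕ} (u : Fin K → ℝ) : Equiv.Perm (Fin K) := Tuple.sort fun k => -u k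

/-- A loss `ℓ prediction utility`: jointly continuous, and `Λ`-Lipschitz in the prediction on
`[-B, B]`, uniformly in the utility in `[0, 1]`. Absolute and squared error are examples. -/
structure IsLoss (B : ℝ) (Λ : ℝ≥0) (ℓ : ℝ → ℝ → ℝ) : Prop where
  continuous : Continuous fun p : ℝ × ℝ => ℓ p.1 p.2
  lipschitz : ∀ u ∈ Icc (0 : ℝ) 1, LipschitzOnWith Λ (fun v => ℓ v u) (Icc (-B) B)

/-- The average loss of the reward `r` on a finite set of labelled examples. -/
def empiricalLoss {ι Z : Type*} [Fintype ι] (ℓ : ℝ → ℝ → ℝ) (data : ι → Z × ℝ) (r : Z → ℝ) : ℝ :=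
  (∑ j, ℓ (r (data j).1) (data j).2) / Fintype.card ι

/-- The expected loss of the reward `r`, averaged over the laws `D j` of the examples; it is the
expected loss under `D` if all the `D j` equal `D`. -/
def populationLoss {ι Z : Type*} [Fintype ι] [MeasurableSpace Z] (ℓ : ℝ → ℝ → ℝ) (U : Z → ℝ)
    (D : ι → Measure Z) (r : Z → ℝ) : ℝ :=
  (∑ j, ∫ z, ℓ (r z) (U z) ∂(D j)) / Fintype.card ι

/-- `r'` minimizes the empirical loss over the class `H`, up to an additive error `η`. -/
def IsApproxERM {ι Z : Type*} [Fintype ι] (ℓ : ℝ → ℝ → ℝ) (H : Set (Z → ℝ)) (η : ℝ)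
    (data : ι → Z × ℝ) (r' : Z → ℝ) : Prop :=
  r' ∈ H ∧ ∀ r ∈ H, empiricalLoss ℓ data r' ≤ empiricalLoss ℓ data r + η

/-- The induced policy `π_r(y | x) ∝ π_ref(y | x) exp (r (x, y) / β)` at the problem `x`. -/
def inducedPolicy {X Y : Type*} [MeasurableSpace X] [MeasurableSpace Y] (πref : Kernel X Y) (β : ℝ)
    (r : X × Y → ℝ) (x : X) : Measure Y :=
  (πref x).tilted fun y => r (x, y) / β

/-- The expected utility of the policy induced by `r`, for a problem drawn from `μ j`, averaged
over `j`; it is the expected utility under `μ` if all the `μ j` equal `μ`, and the average over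
given problems `x j` if `μ j` is the point mass at `x j`. -/
def expectedUtility {ι X Y : Type*} [Fintype ι] [MeasurableSpace X] [MeasurableSpace Y]
    (πref : Kernel X Y) (β : ℝ) (U : X × Y → ℝ) (μ : ι → Measure X) (r : X × Y → ℝ) : ℝ :=
  (∑ j, ∫ x, ∫ y, U (x, y) ∂(inducedPolicy πref β r x) ∂(μ j)) / Fintype.card ι

end

open scoped BigOperators

/-! ### Rademacher sums and chaining -/

/-! Both learning claims are instances of one uniform law of large numbers. A family `g r` of
bounded observables is considered whose squared increments `(g r z - g s z) ^ 2` are controlled by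
the squared distance of `r` and `s` in `L²(κ z)`, for probability measures `κ z` attached to the
sample points (`IsLipschitzObservable`). If, with `m` examples, all empirical sums of `g r` are
within `m * ε / 4` of their expectations, then an `ε / 2`-minimizer of the empirical mean is an
`ε`-minimizer of the expected mean (`IsLipschitzObservable.measure_excess_le`).

The expected largest deviation is bounded by `√m * √d` times a constant. Symmetrization reduces it
to Rademacher sums at two fixed samples `z`, `z'`. There the increments are controlled by the
distance in `L²(Q)`, where `Q` averages all the `κ (z j)` and `κ (z' j)`. The packing numbers of the
class in `L²(Q)` are bounded independently of `Q` (`log_card_le_of_separated`): random points under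
the graphs tell all members of a separated set apart, and Sauer-Shelah counts the traces. Since the
logarithm of these numbers grows only linearly in the scale index, Dudley's chaining sum converges
and no logarithm of `1 / ε` is lost. Markov's inequality then gives failure probability `δ` once `m`
is at least a constant times `d / ε ^ 2`; this is where the dependence of the constant on `δ`
arises.

For empirical risk minimization, `g r` is the loss of `r` minus the loss of the zero prediction, and
`κ z` is the point mass at `z`. For the policy, a change of measure writes the expected utility as
the mean of `U` times the density of the induced policy under the reference policy, so it is
estimated without bias from reference samples. The normalizing integral in this density depends on
`r` at all chains of the problem, which is why `κ z` must also contain a fresh reference draw.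

The ranking claim is separate: independent utilities without atoms almost surely have no ties. -/

/-- The sign `±1` encoded by a Boolean. -/
def radSign (b : Bool) : ℝ := if b then 1 else -1

/-- The signed sum of the coordinates of `a`, with signs `σ`. -/
def radSum {ι : Type*} [Fintype ι] (a : ι → ℝ) (σ : ι → Bool) : ℝ := ∑ j, radSign (σ j) * a j

lemma abs_radSign (b : Bool) : |radSign b| = 1 := by
  cases b <;> simp [radSign]

lemma radSum_sub {ι : Type*} [Fintype ι] (a b : ι → ℝ) (σ : ι → Bool) :
    radSum (a - b) σ = radSum a σ - radSum b σ := by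
  simp [radSum, mul_sub, Finset.sum_sub_distrib]

lemma abs_radSum_le {ι : Type*} [Fintype ι] (a : ι → ℝ) (σ : ι → Bool) :
    |radSum a σ| ≤ √(Fintype.card ι * ∑ j, a j ^ 2) := by
  apply Real.abs_le_sqrt
  have h := Finset.sum_mul_sq_le_sq_mul_sq Finset.univ (fun j => radSign (σ j)) a
  have h1 : ∀ b : Bool, radSign b ^ 2 = 1 := fun b => by
    rw [← sq_abs, abs_radSign, one_pow]
  simpa [radSum, h1] using h

/-- The signs are independent, so the average factors into hyperbolic cosines, and `cosh x ≤ exp (x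
^ 2 / 2)`. -/
lemma expect_exp_radSum_le {ι : Type*} [Fintype ι] [DecidableEq ι] (a : ι → ℝ) (c : ℝ) :
    (𝔼 σ : ι → Bool, Real.exp (c * radSum a σ)) ≤ Real.exp (c ^ 2 * (∑ j, a j ^ 2) / 2) := by
  have h1 : (𝔼 σ : ι → Bool, Real.exp (c * radSum a σ)) = ∏ j, Real.cosh (c * a j) := by
    have h2 : ∀ j, Real.cosh (c * a j) = (∑ b : Bool, Real.exp (c * (radSign b * a j))) / 2 := by
      intro j
      simp [Real.cosh_eq, radSign]
    rw [Finset.prod_congr rfl fun j _ => h2 j, Finset.prod_div_distrib, Fintype.prod_sum,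
      Fintype.expect_eq_sum_div_card]
    congr 1
    · refine Finset.sum_congr rfl fun σ _ => ?_
      rw [← Real.exp_sum, radSum, Finset.mul_sum]
    · simp
  rw [h1]
  calc ∏ j, Real.cosh (c * a j) ≤ ∏ j, Real.exp ((c * a j) ^ 2 / 2) :=
        Finset.prod_le_prod (fun j _ => (Real.cosh_pos _).le) fun j _ => Real.cosh_le_exp_half_sq _
    _ = _ := by
        rw [← Real.exp_sum]
        congr 1
        rw [Finset.mul_sum, Finset.sum_div]
        exact Finset.sum_congr rfl fun j _ => by ring

/-- Massart's finite class lemma, for an arbitrary selection `τ` from the finite class. -/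
lemma expect_abs_radSum_le {ι α : Type*} [Fintype ι] [DecidableEq ι] (T : Finset α)
    (a : α → ι → ℝ) {E v l : ℝ} (hl : 0 < l) (hv : ∀ t ∈ T, ∑ j, a t j ^ 2 ≤ v)
    (hE : Real.log (2 * T.card) ≤ E) (τ : (ι → Bool) → α) (hτ : ∀ σ, τ σ ∈ T) :
    (𝔼 σ : ι → Bool, |radSum (a (τ σ)) σ|) ≤ E / l + l * v / 2 := by
  have hT : (0 : ℝ) < T.card := by
    exact_mod_cast Finset.card_pos.2 ⟨_, hτ fun _ => true⟩
  -- Jensen's inequality is replaced by `x ≤ (c - 1) + exp (x - c)`; this `c` makes the averaged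
  -- exponential term at most `1`. The factor 2 in `hE` pays for the two signs of the absolute
  -- value.
  set c : ℝ := E + l ^ 2 * v / 2 with hc
  have hpt : ∀ σ : ι → Bool, l * |radSum (a (τ σ)) σ| ≤ (c - 1) + Real.exp (-c) *
      ∑ t ∈ T, (Real.exp (l * radSum (a t) σ) + Real.exp (-l * radSum (a t) σ)) := by
    intro σ
    set x := radSum (a (τ σ)) σ with hx
    have h1 : Real.exp (l * |x|) ≤ Real.exp (l * x) + Real.exp (-l * x) := by
      rcases abs_cases x with ⟨h, -⟩ | ⟨h, -⟩ <;> rw [h]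
      · linarith [Real.exp_pos (-l * x)]
      · rw [show l * -x = -l * x by ring]
        linarith [Real.exp_pos (l * x)]
    have h2 : Real.exp (l * x) + Real.exp (-l * x) ≤
        ∑ t ∈ T, (Real.exp (l * radSum (a t) σ) + Real.exp (-l * radSum (a t) σ)) :=
      Finset.single_le_sum
        (f := fun t => Real.exp (l * radSum (a t) σ) + Real.exp (-l * radSum (a t) σ))
        (fun t _ => by positivity) (hτ σ)
    have h3 := Real.add_one_le_exp (l * |x| - c)
    have h4 : Real.exp (l * |x| - c) = Real.exp (-c) * Real.exp (l * |x|) := by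
      rw [← Real.exp_add]; ring_nf
    have h5 := mul_le_mul_of_nonneg_left (h1.trans h2) (Real.exp_pos (-c)).le
    linarith
  have hexp : ∀ t ∈ T, ∀ l' : ℝ, l' ^ 2 = l ^ 2 →
      (𝔼 σ : ι → Bool, Real.exp (l' * radSum (a t) σ)) ≤ Real.exp (l ^ 2 * v / 2) := by
    intro t ht l' hl'
    refine (expect_exp_radSum_le (a t) l').trans (Real.exp_le_exp.2 ?_)
    rw [hl']
    have := hv t ht
    gcongr
  have hsum : l * (𝔼 σ : ι → Bool, |radSum (a (τ σ)) σ|) ≤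
      (c - 1) + Real.exp (-c) * ∑ t ∈ T, (Real.exp (l ^ 2 * v / 2) + Real.exp (l ^ 2 * v / 2)) := by
    rw [Finset.mul_expect]
    refine (Finset.expect_le_expect fun σ _ => hpt σ).trans ?_
    rw [Finset.expect_add_distrib, Finset.expect_const Finset.univ_nonempty, ← Finset.mul_expect,
      Finset.expect_sum_comm]
    gcongr with t ht
    rw [Finset.expect_add_distrib]
    exact add_le_add (hexp t ht l rfl) (hexp t ht (-l) (by ring))
  have hone : Real.exp (-c) *
      ∑ t ∈ T, (Real.exp (l ^ 2 * v / 2) + Real.exp (l ^ 2 * v / 2)) ≤ 1 := by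
    rw [Finset.sum_const, nsmul_eq_mul]
    have h6 : 2 * (T.card : ℝ) ≤ Real.exp E := (Real.log_le_iff_le_exp (by positivity)).1 hE
    calc Real.exp (-c) * (T.card * (Real.exp (l ^ 2 * v / 2) + Real.exp (l ^ 2 * v / 2)))
        = (Real.exp (-c) * Real.exp (l ^ 2 * v / 2)) * (2 * T.card) := by ring
      _ ≤ (Real.exp (-c) * Real.exp (l ^ 2 * v / 2)) * Real.exp E := by gcongr
      _ = 1 := by rw [← Real.exp_add, ← Real.exp_add, hc]; ring_nf; exact Real.exp_zero
  have hfin : l * (𝔼 σ : ι → Bool, |radSum (a (τ σ)) σ|) ≤ c := by linarith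
  rw [mul_comm] at hfin
  calc _ ≤ c / l := (le_div_iff₀ hl).2 hfin
    _ = _ := by rw [hc]; field_simp

/-- Every finite set contains a subset that is `η`-separated and an `η`-net. -/
lemma exists_separated_net {α : Type*} (T : Finset α) (q : α → α → ℝ) (η : ℝ) (hη : 0 ≤ η)
    (hq : ∀ t, q t t = 0) (hsymm : ∀ s t, q s t = q t s) :
    ∃ N ⊆ T, (∀ s ∈ N, ∀ t ∈ N, s ≠ t → η < q s t) ∧ ∀ t ∈ T, ∃ s ∈ N, q t s ≤ η := by
  classical
  obtain ⟨N, hN, hmax⟩ := Finset.exists_max_image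
    (T.powerset.filter fun N => ∀ s ∈ N, ∀ t ∈ N, s ≠ t → η < q s t) Finset.card
    ⟨∅, by simp⟩
  simp only [Finset.mem_filter, Finset.mem_powerset] at hN hmax
  refine ⟨N, hN.1, hN.2, fun t ht => ?_⟩
  by_contra! hcon
  have htN : t ∉ N := fun h => by
    have := hcon t h
    rw [hq] at this
    linarith
  have h1 := hmax (insert t N) ⟨Finset.insert_subset ht hN.1, by
    intro s hs u hu hne
    rcases Finset.mem_insert.1 hs with rfl | hs' <;>
      rcases Finset.mem_insert.1 hu with rfl | hu'
    · exact absurd rfl hne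
    · exact hcon u hu'
    · rw [hsymm]; exact hcon s hs'
    · exact hN.2 s hs' u hu' hne⟩
  rw [Finset.card_insert_of_notMem htN] at h1
  omega

lemma sum_add_mul_half_pow (n : ℕ) :
    ∑ k ∈ Finset.range n, ((k : ℝ) + 5 / 2) * (1 / 2) ^ k = 7 - (2 * n + 7) * (1 / 2) ^ n := by
  induction n with
  | zero => norm_num
  | succ n ih => rw [Finset.sum_range_succ, ih, pow_succ]; push_cast; ring

/-- Dudley's chaining bound for a finite set with packing numbers of logarithm `≤ D (k + 1)` at
squared distance `4⁻ᵏ`. -/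
lemma expect_abs_radSum_le_of_packing {ι α : Type*} [Fintype ι] [DecidableEq ι] (T : Finset α)
    (a : α → ι → ℝ) (q : α → α → ℝ) {S D : ℝ} (hS : 0 < S) (hD : 0 < D)
    (hq : ∀ t, q t t = 0) (hsymm : ∀ s t, q s t = q t s)
    (ha : ∀ t ∈ T, ∑ j, a t j ^ 2 ≤ S ^ 2)
    (haq : ∀ s ∈ T, ∀ t ∈ T, ∑ j, (a s j - a t j) ^ 2 ≤ S ^ 2 * q s t)
    (hpack : ∀ k : ℕ, ∀ N ⊆ T, N.Nonempty → (∀ s ∈ N, ∀ t ∈ N, s ≠ t → (1 / 4) ^ k < q s t) →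
      Real.log (2 * N.card) ≤ D * (k + 1))
    (τ : (ι → Bool) → α) (hτ : ∀ σ, τ σ ∈ T) :
    (𝔼 σ : ι → Bool, |radSum (a (τ σ)) σ|) ≤ 17 / 2 * S * √D := by
  classical
  choose N hNT hNsep hNnet using fun k : ℕ =>
    exists_separated_net T q ((1 / 4) ^ k) (by positivity) hq hsymm
  have hTne : T.Nonempty := ⟨_, hτ fun _ => true⟩
  have hNne : ∀ k, (N k).Nonempty := fun k => by
    obtain ⟨t, ht⟩ := hTne
    obtain ⟨s, hs, -⟩ := hNnet k t ht
    exact ⟨s, hs⟩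
  have hproj : ∀ k, ∃ π : α → α, ∀ t ∈ T, π t ∈ N k ∧ q t (π t) ≤ (1 / 4) ^ k := fun k => by
    choose! π hπ using hNnet k
    exact ⟨π, hπ⟩
  choose π hπ using hproj
  have hsD : 0 < √D := Real.sqrt_pos.2 hD
  have hsq : D / √D = √D := Real.div_sqrt
  have hfour : ∀ k : ℕ, (1 / 4 : ℝ) ^ k = (1 / 2) ^ k * (1 / 2) ^ k := fun k => by
    rw [← mul_pow]; norm_num
  have hbase : ∀ τ : (ι → Bool) → α, (∀ σ, τ σ ∈ N 0) →
      (𝔼 σ : ι → Bool, |radSum (a (τ σ)) σ|) ≤ 3 / 2 * (S * √D) := by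
    intro τ hτ
    have h := expect_abs_radSum_le (N 0) a (div_pos hsD hS) (fun t ht => ha t (hNT 0 ht))
      (hpack 0 (N 0) (hNT 0) (hNne 0) (hNsep 0)) τ hτ
    refine h.trans (le_of_eq ?_)
    simp only [Nat.cast_zero, zero_add, mul_one]
    rw [div_div_eq_mul_div, mul_comm D S, mul_div_assoc, hsq]
    field_simp
    norm_num
  -- A point of `N (n + 1)` determines its projection to `N n`, so at most `(N (n + 1)).card` links
  -- occur and no triangle inequality for `q` is needed. The choice `l = √D * 2 ^ n / S` balances
  -- entropy `D * (n + 2)` against variance `S ^ 2 / 4 ^ n`.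
  have hchain : ∀ n, ∀ τ : (ι → Bool) → α, (∀ σ, τ σ ∈ N n) →
      (𝔼 σ : ι → Bool, |radSum (a (τ σ)) σ|) ≤
        S * √D * (3 / 2 + ∑ k ∈ Finset.range n, ((k : ℝ) + 5 / 2) * (1 / 2) ^ k) := by
    intro n
    induction n with
    | zero => intro τ hτ; simpa [mul_comm] using hbase τ hτ
    | succ n ih =>
      intro τ hτ
      have hmem : ∀ σ, τ σ ∈ T := fun σ => hNT _ (hτ σ)
      have h1 := ih (fun σ => π n (τ σ)) fun σ => (hπ n _ (hmem σ)).1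
      have h2 := expect_abs_radSum_le (N (n + 1)) (fun t => a t - a (π n t))
        (l := √D * 2 ^ n / S) (v := S ^ 2 * ((1 / 2) ^ n * (1 / 2) ^ n)) (by positivity)
        (fun t ht => by
          have h3 := hπ n t (hNT _ ht)
          refine (haq t (hNT _ ht) _ (hNT _ h3.1)).trans ?_
          rw [← hfour]
          exact mul_le_mul_of_nonneg_left h3.2 (by positivity))
        (hpack (n + 1) (N (n + 1)) (hNT _) (hNne _) (hNsep _)) τ hτ
      have h4 : (𝔼 σ : ι → Bool, |radSum (a (τ σ)) σ|) ≤
          (𝔼 σ : ι → Bool, |radSum (a (π n (τ σ))) σ|) +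
            𝔼 σ : ι → Bool, |radSum (a (τ σ) - a (π n (τ σ))) σ| := by
        rw [← Finset.expect_add_distrib]
        refine Finset.expect_le_expect fun σ _ => ?_
        rw [radSum_sub]
        have := abs_add_le (radSum (a (π n (τ σ))) σ)
          (radSum (a (τ σ)) σ - radSum (a (π n (τ σ))) σ)
        simpa using this
      have h5 : D * (((n + 1 : ℕ) : ℝ) + 1) / (√D * 2 ^ n / S) +
          √D * 2 ^ n / S * (S ^ 2 * ((1 / 2) ^ n * (1 / 2) ^ n)) / 2 =
          S * √D * (((n : ℝ) + 5 / 2) * (1 / 2) ^ n) := by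
        have h6 : D = √D * √D := (Real.mul_self_sqrt hD.le).symm
        have h7 : (1 / 2 : ℝ) ^ n = 1 / 2 ^ n := by rw [div_pow, one_pow]
        rw [h7]
        nth_rewrite 1 [h6]
        push_cast
        field_simp
        ring
      rw [h5] at h2
      rw [Finset.sum_range_succ]
      linarith
  -- The remainder beyond level `n` is bounded crudely by Cauchy-Schwarz and vanishes as `n → ∞`.
  -- The links sum to at most `7`, the base level gives `3 / 2`, hence `17 / 2`.
  have hall : ∀ n : ℕ, (𝔼 σ : ι → Bool, |radSum (a (τ σ)) σ|) ≤
      17 / 2 * S * √D + √(Fintype.card ι) * S * (1 / 2) ^ n := by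
    intro n
    have h1 := hchain n (fun σ => π n (τ σ)) fun σ => (hπ n _ (hτ σ)).1
    have h2 : (𝔼 σ : ι → Bool, |radSum (a (τ σ)) σ|) ≤
        𝔼 σ : ι → Bool, (|radSum (a (π n (τ σ))) σ| + √(Fintype.card ι) * S * (1 / 2) ^ n) := by
      refine Finset.expect_le_expect fun σ _ => ?_
      have h3 := hπ n _ (hτ σ)
      have h4 := abs_add_le (radSum (a (π n (τ σ))) σ)
        (radSum (a (τ σ)) σ - radSum (a (π n (τ σ))) σ)
      rw [← radSum_sub, radSum_sub, add_sub_cancel] at h4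
      have h5 := abs_radSum_le (a (τ σ) - a (π n (τ σ))) σ
      have h6 : √(Fintype.card ι * ∑ j, (a (τ σ) - a (π n (τ σ))) j ^ 2) ≤
          √(Fintype.card ι) * S * (1 / 2) ^ n := by
        rw [Real.sqrt_mul (by positivity), mul_assoc]
        gcongr
        refine Real.sqrt_le_iff.2 ⟨by positivity, ?_⟩
        refine (haq _ (hτ σ) _ (hNT _ h3.1)).trans ?_
        calc _ ≤ S ^ 2 * (1 / 4) ^ n := mul_le_mul_of_nonneg_left h3.2 (by positivity)
          _ = _ := by rw [hfour]; ring
      rw [← radSum_sub] at h4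
      linarith
    rw [Finset.expect_add_distrib, Finset.expect_const Finset.univ_nonempty] at h2
    rw [sum_add_mul_half_pow] at h1
    have h7 : S * √D * (3 / 2 + (7 - (2 * n + 7) * (1 / 2) ^ n)) ≤ 17 / 2 * S * √D := by
      have : 0 ≤ S * √D * ((2 * n + 7) * (1 / 2) ^ n) := by positivity
      linarith
    linarith
  have hlim : Tendsto (fun n : ℕ => 17 / 2 * S * √D + √(Fintype.card ι) * S * (1 / 2 : ℝ) ^ n)
      atTop (𝓝 (17 / 2 * S * √D + √(Fintype.card ι) * S * 0)) :=
    tendsto_const_nhds.add ((tendsto_pow_atTop_nhds_zero_of_lt_one (by norm_num)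
      (by norm_num)).const_mul _)
  simpa using ge_of_tendsto' hlim hall

/-! ### Packing numbers of classes of finite VC-dimension -/

lemma ShattersFinset.card_le {α : Type*} {𝒞 : Set (Set α)} {s : Finset α} {d : ℕ}
    (hs : ShattersFinset 𝒞 s) (hd : vcDimension 𝒞 ≤ d) : s.card ≤ d := by
  have h : (s.card : ℕ∞) ≤ vcDimension 𝒞 :=
    le_iSup₂ (f := fun (s : Finset α) (_ : ShattersFinset 𝒞 s) => (s.card : ℕ∞)) s hs
  exact_mod_cast h.trans hd

/-- The Sauer-Shelah lemma for the traces of subgraphs on the points `w i`. -/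
lemma card_le_sum_choose_of_separated {Z : Type*} {H : Set (Z → ℝ)} {d k : ℕ}
    (hd : rewardVCDim H ≤ d) (S : Finset (Z → ℝ)) (hS : ∀ r ∈ S, r ∈ H) (w : Fin k → Z × ℝ)
    (hw : ∀ r ∈ S, ∀ s ∈ S, r ≠ s → ∃ i, ¬(w i ∈ subgraph r ↔ w i ∈ subgraph s)) :
    S.card ≤ ∑ i ∈ Finset.Iic d, k.choose i := by
  classical
  let tr : (Z → ℝ) → Finset (Fin k) := fun r => Finset.univ.filter fun i => w i ∈ subgraph r
  have hmem : ∀ r i, i ∈ tr r ↔ w i ∈ subgraph r := fun r i => by simp [tr]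
  have hinj : Set.InjOn tr S := by
    intro r hr s hs hrs
    by_contra hne
    obtain ⟨i, hi⟩ := hw r hr s hs hne
    exact hi (by rw [← hmem, ← hmem, hrs])
  have hvc : (S.image tr).vcDim ≤ d := by
    refine Finset.sup_le fun t ht => ?_
    have hsh := Finset.mem_shatterer.1 ht
    have hcut : ∀ u ⊆ t, ∃ r ∈ S, ∀ i ∈ t, w i ∈ subgraph r ↔ i ∈ u := by
      intro u hu
      obtain ⟨v, hv, hvu⟩ := hsh hu
      obtain ⟨r, hr, rfl⟩ := Finset.mem_image.1 hv
      refine ⟨r, hr, fun i hi => ?_⟩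
      rw [← hmem, ← hvu, Finset.mem_inter]
      exact ⟨fun h => ⟨hi, h⟩, fun h => h.2⟩
    -- The points `w i` may repeat, but not on a shattered index set: a singleton cut would fail to
    -- separate equal points. Hence the shattered set of points has as many elements as `t`.
    have hwinj : Set.InjOn w t := by
      intro i hi j hj hij
      by_contra hne
      obtain ⟨r, -, hr⟩ := hcut {i} (by simpa using hi)
      have h1 := (hr i hi).2 (by simp)
      rw [hij] at h1
      have h2 := (hr j hj).1 h1
      exact hne (Finset.mem_singleton.1 h2).symm
    rw [← Finset.card_image_of_injOn hwinj]
    refine ShattersFinset.card_le (𝒞 := subgraph '' H) ?_ hd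
    intro u hu
    obtain ⟨r, hr, hru⟩ := hcut (t.filter fun i => w i ∈ u) (Finset.filter_subset _ _)
    refine ⟨subgraph r, ⟨r, hS r hr, rfl⟩, fun p hp => ?_⟩
    obtain ⟨i, hi, rfl⟩ := Finset.mem_image.1 hp
    rw [hru i hi, Finset.mem_filter]
    exact ⟨fun h => h.2, fun h => ⟨hi, h⟩⟩
  calc S.card = (S.image tr).card := (Finset.card_image_of_injOn hinj).symm
    _ ≤ (S.image tr).shatterer.card := Finset.card_le_card_shatterer _
    _ ≤ ∑ i ∈ Finset.Iic (S.image tr).vcDim, (Fintype.card (Fin k)).choose i :=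
        Finset.card_shatterer_le_sum_vcDim
    _ ≤ ∑ i ∈ Finset.Iic d, k.choose i := by
        rw [Fintype.card_fin]
        exact Finset.sum_le_sum_of_subset (Finset.Iic_subset_Iic.2 hvc)

/-- Since `x ^ d ≤ x ^ i` for `i ≤ d`, the sum is dominated by the binomial expansion of `(1 + x) ^
k`. Keeping `x` free avoids a case distinction between `k` and `d`. -/
lemma sum_choose_mul_pow_le (d k : ℕ) {x : ℝ} (hx : 0 < x) (hx1 : x ≤ 1) :
    ((∑ i ∈ Finset.Iic d, k.choose i : ℕ) : ℝ) * x ^ d ≤ Real.exp (k * x) := by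
  have h0 : ((∑ i ∈ Finset.Iic d, k.choose i : ℕ) : ℝ) * x ^ d ≤
      ∑ i ∈ Finset.Iic d, (k.choose i : ℝ) * x ^ i := by
    push_cast
    rw [Finset.sum_mul]
    refine Finset.sum_le_sum fun i hi => ?_
    exact mul_le_mul_of_nonneg_left
      (pow_le_pow_of_le_one hx.le hx1 (Finset.mem_Iic.1 hi)) (by positivity)
  have h1 : ∑ i ∈ Finset.Iic d, (k.choose i : ℝ) * x ^ i ≤
      ∑ i ∈ Finset.range (max d k + 1), (k.choose i : ℝ) * x ^ i := by
    refine Finset.sum_le_sum_of_subset_of_nonneg (fun i hi => ?_) fun _ _ _ => by positivity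
    have := Finset.mem_Iic.1 hi
    exact Finset.mem_range.2 (by omega)
  have h2 : ∑ i ∈ Finset.range (max d k + 1), (k.choose i : ℝ) * x ^ i =
      ∑ i ∈ Finset.range (k + 1), (k.choose i : ℝ) * x ^ i := by
    symm
    refine Finset.sum_subset (Finset.range_subset_range.2 (by omega)) fun i _ hi => ?_
    rw [Nat.choose_eq_zero_of_lt (by simpa using hi)]
    simp
  have h3 : ∑ i ∈ Finset.range (k + 1), (k.choose i : ℝ) * x ^ i = (x + 1) ^ k := by
    rw [add_pow]
    exact Finset.sum_congr rfl fun i _ => by ring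
  have h4 : (x + 1) ^ k ≤ Real.exp (k * x) := by
    rw [mul_comm, Real.exp_mul, Real.rpow_natCast]
    exact pow_le_pow_left₀ (by positivity) (Real.add_one_le_exp x) k
  linarith

lemma measurableSet_subgraph {Z : Type*} [MeasurableSpace Z] {r : Z → ℝ} (hr : Measurable r) :
    MeasurableSet (subgraph r) :=
  measurableSet_lt measurable_snd (hr.comp measurable_fst)

/-- A uniform threshold falls between `a` and `b` with probability `|a - b| / (2 * B)`. This ratio
is at most `1`, so it dominates its square. With Fubini, `L²` separation becomes disagreement of
subgraphs at random points. -/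
lemma cond_Icc_subgraph_disagree {B a b : ℝ} (hB : 0 < B) (ha : |a| ≤ B) (hb : |b| ≤ B) :
    ENNReal.ofReal ((a - b) ^ 2 / (4 * B ^ 2)) ≤
      (volume[|Icc (-B) B]) {t : ℝ | ¬(t < a ↔ t < b)} := by
  wlog hab : a ≤ b generalizing a b
  · have := this hb ha (le_of_not_ge hab)
    convert this using 2
    · ring
    · ext t; simp only [Set.mem_ofPred_eq]; tauto
  rw [cond_apply measurableSet_Icc]
  rw [abs_le] at ha hb
  have hsub : Ico a b ⊆ Icc (-B) B ∩ {t : ℝ | ¬(t < a ↔ t < b)} := by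
    intro t ht
    refine ⟨⟨by linarith [ht.1], by linarith [ht.2]⟩, fun h => ?_⟩
    exact absurd (h.2 ht.2) (not_lt.2 ht.1)
  refine le_trans ?_ (mul_le_mul_right (measure_mono hsub) _)
  rw [Real.volume_Icc, Real.volume_Ico, ← ENNReal.ofReal_inv_of_pos (by linarith),
    ← ENNReal.ofReal_mul (by rw [inv_nonneg]; linarith)]
  apply ENNReal.ofReal_le_ofReal
  have h1 : b - a ≤ 2 * B := by linarith
  rw [show B - -B = 2 * B by ring, inv_mul_eq_div, div_le_div_iff₀ (by positivity) (by positivity)]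
  nlinarith [mul_le_mul_of_nonneg_left h1 (sub_nonneg.2 hab)]

lemma ofReal_integral_sq_le_prod_disagree {Z : Type*} [MeasurableSpace Z] (Q : Measure Z)
    [IsProbabilityMeasure Q] {B : ℝ} (hB : 0 < B) {r s : Z → ℝ} (hr : Measurable r)
    (hs : Measurable s) (hrB : ∀ z, |r z| ≤ B) (hsB : ∀ z, |s z| ≤ B) :
    ENNReal.ofReal ((∫ z, (r z - s z) ^ 2 ∂Q) / (4 * B ^ 2)) ≤
      (Q.prod (volume[|Icc (-B) B])) {p | ¬(p ∈ subgraph r ↔ p ∈ subgraph s)} := by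
  have hmeas : MeasurableSet {p : Z × ℝ | ¬(p ∈ subgraph r ↔ p ∈ subgraph s)} := by
    have h1 := measurableSet_subgraph hr
    have h2 := measurableSet_subgraph hs
    measurability
  rw [Measure.prod_apply hmeas, ← integral_div, ofReal_integral_eq_lintegral_ofReal]
  · exact lintegral_mono fun z => cond_Icc_subgraph_disagree hB (hrB z) (hsB z)
  · refine Integrable.of_bound (C := 1)
      (((hr.sub hs).pow_const 2).div_const _).aestronglyMeasurable (ae_of_all _ fun z => ?_)
    rw [Real.norm_of_nonneg (by positivity), div_le_one (by positivity)]
    have h1 := abs_le.1 (hrB z)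
    have h2 := abs_le.1 (hsB z)
    nlinarith
  · exact ae_of_all _ fun z => by positivity

/-- A finite subset of a class of VC-dimension at most `d` that is separated in `L²(Q)` has at
most polynomially many elements. -/
lemma log_card_le_of_separated {Z : Type*} [MeasurableSpace Z] (Q : Measure Z)
    [IsProbabilityMeasure Q] {B : ℝ} (hB : 0 < B) {H : Set (Z → ℝ)} (hH : IsRewardClass B H)
    {d : ℕ} (hd : rewardVCDim H ≤ d) (S : Finset (Z → ℝ)) (hS : ∀ r ∈ S, r ∈ H)
    (hne : S.Nonempty) {p : ℝ} (hp : 0 < p) (hp1 : p ≤ 1)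
    (hsep : ∀ r ∈ S, ∀ s ∈ S, r ≠ s → p ≤ (∫ z, (r z - s z) ^ 2 ∂Q) / (4 * B ^ 2)) :
    Real.log S.card ≤ 2 * d * Real.log (4 / p) + 1 / 2 := by
  classical
  have : IsProbabilityMeasure (volume[|Icc (-B) B]) := by
    apply cond_isProbabilityMeasure_of_finite <;> rw [Real.volume_Icc]
    · simpa using hB
    · exact ENNReal.ofReal_ne_top
  set M : ℝ := (S.card : ℝ) with hM
  have hM1 : 1 ≤ M := by
    rw [hM]; exact_mod_cast Finset.card_pos.2 hne
  -- With `k` random points a given pair goes undistinguished with probability at most `(1 - p) ^ k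
  -- ≤ 1 / M ^ 2`. There are fewer than `M ^ 2` ordered pairs, so some `w` distinguishes all of
  -- them.
  set k : ℕ := ⌈2 * Real.log M / p⌉₊ with hk
  have hk1 : 2 * Real.log M ≤ p * k := by
    have := Nat.le_ceil (2 * Real.log M / p)
    rw [div_le_iff₀ hp] at this
    linarith
  have hk2 : (k : ℝ) * p ≤ 2 * Real.log M + p := by
    have := (Nat.ceil_lt_add_one (a := 2 * Real.log M / p)
      (by have := Real.log_nonneg hM1; positivity)).le
    calc (k : ℝ) * p ≤ (2 * Real.log M / p + 1) * p := by gcongr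
      _ = _ := by field_simp
  set ν := Q.prod (volume[|Icc (-B) B]) with hν
  let A : (Z → ℝ) × (Z → ℝ) → Set (Z × ℝ) := fun q => {x | x ∈ subgraph q.1 ↔ x ∈ subgraph q.2}
  have hA : ∀ q ∈ S.offDiag, ν (A q) ≤ ENNReal.ofReal (1 - p) := by
    intro q hq
    rw [Finset.mem_offDiag] at hq
    have hr := hS _ hq.1
    have hs := hS _ hq.2.1
    have hmeas : MeasurableSet (A q) := by
      have h1 := measurableSet_subgraph (hH.measurable _ hr)
      have h2 := measurableSet_subgraph (hH.measurable _ hs)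
      simp only [A]
      measurability
    have h1 := ofReal_integral_sq_le_prod_disagree Q hB (hH.measurable _ hr) (hH.measurable _ hs)
      (hH.bounded _ hr) (hH.bounded _ hs)
    have h2 : ENNReal.ofReal p ≤ ν (A q)ᶜ :=
      (ENNReal.ofReal_le_ofReal (hsep _ hq.1 _ hq.2.1 hq.2.2)).trans h1
    rw [prob_compl_eq_one_sub hmeas] at h2
    rw [ENNReal.ofReal_sub _ hp.le, ENNReal.ofReal_one]
    exact ENNReal.le_sub_of_add_le_left ENNReal.ofReal_ne_top
      ((add_le_add_left h2 _).trans (tsub_add_cancel_of_le prob_le_one).le)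
  have hbad : (Measure.pi fun _ : Fin k => ν) (⋃ q ∈ S.offDiag, Set.univ.pi fun _ => A q) < 1 := by
    refine (measure_biUnion_finset_le _ _).trans_lt ?_
    have h1 : ∀ q ∈ S.offDiag, (Measure.pi fun _ : Fin k => ν) (Set.univ.pi fun _ => A q) ≤
        ENNReal.ofReal (M ^ 2)⁻¹ := by
      intro q hq
      rw [Measure.pi_pi, Finset.prod_const, Finset.card_univ, Fintype.card_fin]
      refine (pow_le_pow_left' (hA q hq) k).trans ?_
      rw [← ENNReal.ofReal_pow (by linarith)]
      apply ENNReal.ofReal_le_ofReal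
      calc (1 - p) ^ k ≤ Real.exp (-p) ^ k := by
            refine pow_le_pow_left₀ (by linarith) ?_ k
            linarith [Real.add_one_le_exp (-p)]
        _ = Real.exp (-(p * k)) := by rw [← Real.exp_nat_mul]; ring_nf
        _ ≤ Real.exp (-(2 * Real.log M)) := by gcongr
        _ = (M ^ 2)⁻¹ := by
            rw [Real.exp_neg, mul_comm, Real.exp_mul, Real.exp_log (by linarith)]
            norm_num
    refine (Finset.sum_le_sum h1).trans_lt ?_
    rw [Finset.sum_const, nsmul_eq_mul, Finset.offDiag_card, ← ENNReal.ofReal_natCast,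
      ← ENNReal.ofReal_mul (by positivity), ← ENNReal.ofReal_one]
    rw [ENNReal.ofReal_lt_ofReal_iff one_pos, Nat.cast_sub (Nat.le_mul_self _)]
    push_cast
    rw [← hM, ← div_eq_mul_inv, div_lt_one (by positivity)]
    nlinarith
  obtain ⟨w, hw⟩ : ∃ w : Fin k → Z × ℝ, w ∉ ⋃ q ∈ S.offDiag, Set.univ.pi fun _ => A q := by
    by_contra! hcon
    rw [Set.eq_univ_of_forall hcon, measure_univ] at hbad
    exact lt_irrefl _ hbad
  have hcard := card_le_sum_choose_of_separated hd S hS w fun r hr s hs hrs => by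
    by_contra! hcon
    exact hw (Set.mem_iUnion₂.2 ⟨(r, s), Finset.mem_offDiag.2 ⟨hr, hs, hrs⟩, fun i _ => hcon i⟩)
  -- With `x = p / 4` the exponent `k * x` is at most `log M / 2 + p / 4`, so half of `log M` can be
  -- absorbed on the left.
  have hx : 0 < p / 4 := by positivity
  have hfin : M * (p / 4) ^ d ≤ Real.exp (k * (p / 4)) := by
    refine le_trans ?_ (sum_choose_mul_pow_le d k hx (by linarith))
    gcongr
    rw [hM]
    exact_mod_cast hcard
  have hlog := Real.log_le_log (by positivity) hfin
  rw [Real.log_exp, Real.log_mul (by positivity) (by positivity), Real.log_pow] at hlog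
  have hinv : Real.log (p / 4) = -Real.log (4 / p) := by rw [← Real.log_inv, inv_div]
  rw [hinv] at hlog
  linarith

lemma log_two_mul_card_le_of_separated {Z : Type*} [MeasurableSpace Z] (Q : Measure Z)
    [IsProbabilityMeasure Q] {B : ℝ} (hB : 0 < B) {H : Set (Z → ℝ)} (hH : IsRewardClass B H)
    {d : ℕ} (hd0 : 1 ≤ d) (hd : rewardVCDim H ≤ d) (S : Finset (Z → ℝ)) (hS : ∀ r ∈ S, r ∈ H)
    (hne : S.Nonempty) (k : ℕ)
    (hsep : ∀ r ∈ S, ∀ s ∈ S, r ≠ s → (1 / 4) ^ k < (∫ z, (r z - s z) ^ 2 ∂Q) / B ^ 2) :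
    Real.log (2 * S.card) ≤ 7 * d * (k + 1) := by
  -- The extra factor `1 / 4` in `p` comes from normalizing by `4 * B ^ 2` instead of `B ^ 2`.
  have h := log_card_le_of_separated Q hB hH hd S hS hne (p := (1 / 4) ^ (k + 1)) (by positivity)
    (pow_le_one₀ (by norm_num) (by norm_num)) fun r hr s hs hrs => by
      have := hsep r hr s hs hrs
      rw [pow_succ, mul_comm 4, ← div_div]
      linarith
  have hlog : Real.log (4 / (1 / 4) ^ (k + 1)) = (k + 2) * (2 * Real.log 2) := by
    rw [Real.log_div (by norm_num) (by positivity), Real.log_pow, Real.log_div (by norm_num)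
      (by norm_num), Real.log_one, show (4 : ℝ) = 2 ^ 2 by norm_num, Real.log_pow]
    push_cast
    ring
  have hM : (0 : ℝ) < S.card := by exact_mod_cast Finset.card_pos.2 hne
  rw [Real.log_mul (by norm_num) hM.ne']
  rw [hlog] at h
  have hl2 := Real.log_two_lt_d9
  have hd1 : (1 : ℝ) ≤ d := by exact_mod_cast hd0
  have hk : (0 : ℝ) ≤ k := by positivity
  have h1 : (2 * d * ((k + 2) * (2 * Real.log 2)) : ℝ) ≤ 2 * d * ((k + 2) * (2 * 0.6931471808)) := by
    gcongr
  nlinarith [mul_nonneg (sub_nonneg.2 hd1) hk]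

/-! ### Symmetrization -/

lemma measurePreserving_swap_of_signs {ι Z : Type*} [Fintype ι] [MeasurableSpace Z]
    (D : ι → Measure Z) [∀ j, IsProbabilityMeasure (D j)] (σ : ι → Bool) :
    MeasurePreserving (fun (p : ι → Z × Z) j => if σ j then p j else (p j).swap)
      (Measure.pi fun j => (D j).prod (D j)) (Measure.pi fun j => (D j).prod (D j)) := by
  refine measurePreserving_pi _ _ (f := fun j (x : Z × Z) => if σ j then x else x.swap) fun j => ?_
  cases σ j
  · simpa using Measure.measurePreserving_swap
  · exact MeasurePreserving.id _

lemma abs_sum_sub_sum_le {ι Z : Type*} [Fintype ι] {f : Z → ℝ} {G : ℝ} (hf : ∀ z, |f z| ≤ G)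
    (z z' : ι → Z) : |∑ j, (f (z j) - f (z' j))| ≤ Fintype.card ι * (2 * G) := by
  refine (Finset.abs_sum_le_sum_abs _ _).trans ?_
  refine (Finset.sum_le_card_nsmul _ _ (2 * G) fun j _ => ?_).trans (by simp)
  have h := abs_sub (f (z j)) (f (z' j))
  linarith [hf (z j), hf (z' j)]

lemma integrable_sup_abs {α Ω : Type*} [MeasurableSpace Ω] {P : Measure Ω} [IsFiniteMeasure P]
    {S : Finset α} (hS : S.Nonempty) {F : α → Ω → ℝ} (hF : ∀ t ∈ S, Measurable (F t)) {M : ℝ}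
    (hM : ∀ t ∈ S, ∀ ω, |F t ω| ≤ M) :
    Integrable (fun ω => S.sup' hS fun t => |F t ω|) P := by
  have hmeas : Measurable (fun ω => S.sup' hS fun t => |F t ω|) := by
    have := Finset.measurable_sup' hS (f := fun t ω => |F t ω|) fun t ht => (hF t ht).abs
    convert this using 1
    ext ω
    rw [Finset.sup'_apply]
  refine Integrable.of_bound hmeas.aestronglyMeasurable M (ae_of_all _ fun ω => ?_)
  obtain ⟨t, ht, h⟩ := Finset.exists_mem_eq_sup' hS fun t => |F t ω|
  rw [h, Real.norm_eq_abs, abs_abs]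
  exact hM t ht ω

/-- Symmetrization: the expected maximal deviation over a finite class is bounded by a uniform
bound for the Rademacher averages of differences. -/
lemma integral_sup_deviation_le {ι Z α : Type*} [Fintype ι] [DecidableEq ι] [MeasurableSpace Z]
    (D : ι → Measure Z) [∀ j, IsProbabilityMeasure (D j)] {S : Finset α} (hS : S.Nonempty)
    (f : α → Z → ℝ) (hf : ∀ t ∈ S, Measurable (f t)) {G : ℝ} (hG : ∀ t ∈ S, ∀ z, |f t z| ≤ G)
    {R : ℝ} (hR : ∀ (z z' : ι → Z) (τ : (ι → Bool) → α), (∀ σ, τ σ ∈ S) →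
      (𝔼 σ : ι → Bool, |radSum (fun j => f (τ σ) (z j) - f (τ σ) (z' j)) σ|) ≤ R) :
    ∫ z, S.sup' hS (fun t => |∑ j, f t (z j) - ∑ j, ∫ x, f t x ∂(D j)|) ∂(Measure.pi D) ≤ R := by
  set P := Measure.pi D with hP
  let W : (ι → Z) → (ι → Z) → ℝ := fun z z' => S.sup' hS fun t => |∑ j, (f t (z j) - f t (z' j))|
  have hint : ∀ t ∈ S, ∀ j, Integrable (fun z : ι → Z => f t (z j)) P := fun t ht j =>
    Integrable.of_bound ((hf t ht).comp (measurable_pi_apply j)).aestronglyMeasurable G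
      (ae_of_all _ fun z => hG t ht _)
  have hsumint : ∀ t ∈ S, Integrable (fun z : ι → Z => ∑ j, f t (z j)) P := fun t ht =>
    integrable_finsetSum _ fun j _ => hint t ht j
  have hmean : ∀ t ∈ S, ∫ z, ∑ j, f t (z j) ∂P = ∑ j, ∫ x, f t x ∂(D j) := by
    intro t ht
    rw [integral_finsetSum _ fun j _ => hint t ht j]
    exact Finset.sum_congr rfl fun j _ => integral_comp_eval (hf t ht).aestronglyMeasurable
  have hWint : Integrable (fun p : (ι → Z) × (ι → Z) => W p.1 p.2) (P.prod P) := by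
    refine integrable_sup_abs hS (fun t ht => ?_) fun t ht p => abs_sum_sub_sum_le (hG t ht) p.1 p.2
    refine Finset.measurable_sum _ fun j _ => ?_
    exact ((hf t ht).comp ((measurable_pi_apply j).comp measurable_fst)).sub
      ((hf t ht).comp ((measurable_pi_apply j).comp measurable_snd))
  have hW1 : ∀ z, Integrable (fun z' => W z z') P := fun z => by
    refine integrable_sup_abs hS (fun t ht => ?_) fun t ht z' => abs_sum_sub_sum_le (hG t ht) z z'
    exact Finset.measurable_sum _ fun j _ =>
      measurable_const.sub ((hf t ht).comp (measurable_pi_apply j))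
  -- The expectation is an average over an independent ghost sample `z'`, and the supremum of
  -- averages is at most the average of suprema.
  have hstep1 : ∀ z, S.sup' hS (fun t => |∑ j, f t (z j) - ∑ j, ∫ x, f t x ∂(D j)|) ≤
      ∫ z', W z z' ∂P := by
    intro z
    refine Finset.sup'_le _ _ fun t ht => ?_
    have h1 : ∑ j, f t (z j) - ∑ j, ∫ x, f t x ∂(D j) =
        ∫ z', ∑ j, (f t (z j) - f t (z' j)) ∂P := by
      simp_rw [Finset.sum_sub_distrib]
      rw [integral_sub (integrable_const _) (hsumint t ht), hmean t ht]
      simp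
    rw [h1]
    refine abs_integral_le_integral_abs.trans (integral_mono ?_ (hW1 z) fun z' => ?_)
    · simp_rw [Finset.sum_sub_distrib]
      exact ((integrable_const _).sub (hsumint t ht)).abs
    · exact Finset.le_sup' (fun t => |∑ j, (f t (z j) - f t (z' j))|) ht
  set PP := Measure.pi fun j => (D j).prod (D j) with hPP
  let V : (ι → Bool) → (ι → Z × Z) → ℝ := fun σ p =>
    S.sup' hS fun t => |radSum (fun j => f t (p j).1 - f t (p j).2) σ|
  have hVmeas : ∀ σ, ∀ t ∈ S, Measurable fun p : ι → Z × Z =>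
      radSum (fun j => f t (p j).1 - f t (p j).2) σ := fun σ t ht => by
    refine Finset.measurable_sum _ fun j _ => Measurable.const_mul ?_ _
    exact ((hf t ht).comp (measurable_fst.comp (measurable_pi_apply j))).sub
      ((hf t ht).comp (measurable_snd.comp (measurable_pi_apply j)))
  have hflip : ∀ (σ : ι → Bool) t (p : ι → Z × Z),
      radSum (fun j => f t (p j).1 - f t (p j).2) σ =
      ∑ j, (f t (if σ j then p j else (p j).swap).1 - f t (if σ j then p j else (p j).swap).2) := by
    intro σ t p
    refine Finset.sum_congr rfl fun j _ => ?_
    cases σ j <;> simp [radSign]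
  have hVint : ∀ σ, Integrable (V σ) PP := fun σ => by
    refine integrable_sup_abs hS (hVmeas σ) (M := Fintype.card ι * (2 * G)) fun t ht p => ?_
    rw [hflip]
    exact abs_sum_sub_sum_le (hG t ht) (fun j => (if σ j then p j else (p j).swap).1)
      (fun j => (if σ j then p j else (p j).swap).2)
  -- A negative sign at `j` amounts to exchanging `z j` and `z' j`, which preserves the joint law.
  have hstep3 : ∀ σ, ∫ p, V σ p ∂PP = ∫ p, W p.1 p.2 ∂(P.prod P) := by
    intro σ
    rw [← (measurePreserving_arrowProdEquivProdArrow Z Z ι D D).integral_comp'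
      (fun p => W p.1 p.2)]
    have hmp := measurePreserving_swap_of_signs D σ
    have hWmeas : AEStronglyMeasurable
        (fun p : ι → Z × Z => W (fun j => (p j).1) fun j => (p j).2) PP := by
      have := hWint.aestronglyMeasurable.comp_measurePreserving
        (measurePreserving_arrowProdEquivProdArrow Z Z ι D D)
      exact this
    have h2 := integral_map (μ := PP) hmp.measurable.aemeasurable
      (f := fun p : ι → Z × Z => W (fun j => (p j).1) fun j => (p j).2)
      (by rw [hmp.map_eq]; exact hWmeas)
    rw [hmp.map_eq] at h2
    refine Eq.trans ?_ h2.symm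
    refine integral_congr_ae (ae_of_all _ fun p => ?_)
    simp only [V, W, hflip]
  calc _ ≤ ∫ z, ∫ z', W z z' ∂P ∂P := by
        refine integral_mono ?_ hWint.integral_prod_left hstep1
        refine integrable_sup_abs hS (M := Fintype.card ι * (2 * G)) (fun t ht => ?_)
          fun t ht z => ?_
        · exact (Finset.measurable_sum _ fun j _ =>
            (hf t ht).comp (measurable_pi_apply j)).sub_const _
        · have h2 : |∑ j, f t (z j) - ∑ j, ∫ x, f t x ∂(D j)| ≤
              ∑ j : ι, (|f t (z j)| + |∫ x, f t x ∂(D j)|) := by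
            rw [← Finset.sum_sub_distrib]
            exact (Finset.abs_sum_le_sum_abs _ _).trans (Finset.sum_le_sum fun j _ => abs_sub _ _)
          refine h2.trans ((Finset.sum_le_card_nsmul _ _ (2 * G) fun j _ => ?_).trans (by simp))
          have h3 := norm_integral_le_of_norm_le_const (μ := D j) (f := f t) (C := G)
            (ae_of_all _ fun x => hG t ht x)
          rw [Real.norm_eq_abs] at h3
          simp only [probReal_univ, mul_one] at h3
          linarith [hG t ht (z j)]
    _ = ∫ p, W p.1 p.2 ∂(P.prod P) := (integral_prod _ hWint).symm
    _ = 𝔼 σ : ι → Bool, ∫ p, V σ p ∂PP := by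
        rw [Finset.expect_congr rfl fun σ _ => hstep3 σ, Finset.expect_const Finset.univ_nonempty]
    _ = ∫ p, 𝔼 σ : ι → Bool, V σ p ∂PP := by
        simp_rw [Fintype.expect_eq_sum_div_card]
        rw [integral_div, integral_finsetSum _ fun σ _ => hVint σ]
    _ ≤ ∫ _, R ∂PP := by
        refine integral_mono ?_ (integrable_const _) fun p => ?_
        · simp_rw [Fintype.expect_eq_sum_div_card]
          exact (integrable_finsetSum _ fun σ _ => hVint σ).div_const _
        · choose τ hτ hV using fun σ : ι → Bool => Finset.exists_mem_eq_sup' hS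
            fun t => |radSum (fun j => f t (p j).1 - f t (p j).2) σ|
          refine le_trans (le_of_eq (Finset.expect_congr rfl fun σ _ => hV σ)) ?_
          exact hR (fun j => (p j).1) (fun j => (p j).2) τ hτ
    _ = R := by simp

/-! ### Uniform deviations -/

/-- A family `g r` of observables indexed by rewards, Lipschitz in the reward with respect to
`L²`-distances of measures attached to the sample points. -/
structure IsLipschitzObservable {Z : Type*} [MeasurableSpace Z] (H : Set (Z → ℝ))
    (κ : Z → Measure Z) (G L : ℝ) (g : (Z → ℝ) → Z → ℝ) : Prop where
  measurable : ∀ r ∈ H, Measurable (g r)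
  bounded : ∀ r ∈ H, ∀ z, |g r z| ≤ G
  lipschitz : ∀ r ∈ H, ∀ s ∈ H, ∀ z, (g r z - g s z) ^ 2 ≤ L ^ 2 * ∫ x, (r x - s x) ^ 2 ∂(κ z)
  tendsto : ∀ r ∈ H, ∀ s : ℕ → Z → ℝ, (∀ t, s t ∈ H) →
    (∀ z, Tendsto (fun t => s t z) atTop (𝓝 (r z))) →
    ∀ z, Tendsto (fun t => g (s t) z) atTop (𝓝 (g r z))

lemma IsRewardClass.integrable_sub_sq {Z : Type*} [MeasurableSpace Z] {B : ℝ} {H : Set (Z → ℝ)}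
    (hH : IsRewardClass B H) (Q : Measure Z) [IsFiniteMeasure Q] {r s : Z → ℝ} (hr : r ∈ H)
    (hs : s ∈ H) : Integrable (fun z => (r z - s z) ^ 2) Q := by
  refine Integrable.of_bound (C := (2 * B) ^ 2) (((hH.measurable r hr).sub
    (hH.measurable s hs)).pow_const 2).aestronglyMeasurable (ae_of_all _ fun z => ?_)
  have h1 := abs_le.1 (hH.bounded r hr z)
  have h2 := abs_le.1 (hH.bounded s hs z)
  rw [Real.norm_of_nonneg (by positivity)]
  exact sq_le_sq' (by linarith) (by linarith)

/-- Chaining is applied to the vectors of differences `g r (z j) - g r (z' j)`. The scale `2 * √m *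
(G + L * B)` dominates both their norms, at most `2 * √m * G`, and their increments, at most `2 * √m
* L` times the `L²(Q)` distance. Numerically `17 * √7 ≤ 45`. -/
lemma IsLipschitzObservable.expect_abs_radSum_le {ι Z : Type*} [Fintype ι] [DecidableEq ι]
    [Nonempty ι] [MeasurableSpace Z] {B : ℝ} (hB : 0 < B) {H : Set (Z → ℝ)}
    (hH : IsRewardClass B H) {d : ℕ} (hd0 : 1 ≤ d) (hd : rewardVCDim H ≤ d) {κ : Z → Measure Z}
    [∀ z, IsProbabilityMeasure (κ z)] {G L : ℝ} (hG : 0 < G) (hL : 0 ≤ L)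
    {g : (Z → ℝ) → Z → ℝ} (hg : IsLipschitzObservable H κ G L g) (S : Finset (Z → ℝ))
    (hS : ∀ r ∈ S, r ∈ H) (z z' : ι → Z) (τ : (ι → Bool) → Z → ℝ) (hτ : ∀ σ, τ σ ∈ S) :
    (𝔼 σ : ι → Bool, |radSum (fun j => g (τ σ) (z j) - g (τ σ) (z' j)) σ|) ≤
      45 * √(Fintype.card ι) * √d * (G + L * B) := by
  set m : ℝ := (Fintype.card ι : ℝ) with hm
  have hm0 : 0 < m := by rw [hm]; exact_mod_cast Fintype.card_pos
  have hd1 : (0 : ℝ) < d := by exact_mod_cast hd0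
  let Q : Measure Z := ENNReal.ofReal (2 * m)⁻¹ • ∑ j, (κ (z j) + κ (z' j))
  have hQint : ∀ f : Z → ℝ, (∀ P : Measure Z, IsFiniteMeasure P → Integrable f P) →
      ∫ x, f x ∂Q = (2 * m)⁻¹ * ∑ j, (∫ x, f x ∂(κ (z j)) + ∫ x, f x ∂(κ (z' j))) := by
    intro f hf
    rw [integral_smul_measure, ENNReal.toReal_ofReal (by positivity), smul_eq_mul,
      integral_finsetSum_measure fun j _ => hf _ inferInstance]
    congr 1
    exact Finset.sum_congr rfl fun j _ =>
      integral_add_measure (hf _ inferInstance) (hf _ inferInstance)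
  have : IsProbabilityMeasure Q := by
    constructor
    simp only [Q, Measure.smul_apply, Measure.coe_finsetSum, Finset.sum_apply, Measure.add_apply,
      measure_univ, Finset.sum_const, smul_eq_mul, nsmul_eq_mul, Finset.card_univ]
    rw [show ((Fintype.card ι : ℝ≥0∞) * (1 + 1)) = ENNReal.ofReal (2 * m) by
      rw [mul_comm, ENNReal.ofReal_mul (by norm_num), hm, ENNReal.ofReal_natCast]; norm_num,
      ← ENNReal.ofReal_mul (by positivity), inv_mul_cancel₀ (by positivity), ENNReal.ofReal_one]
  have hLB : 0 ≤ L * B := by positivity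
  have hsq : ∀ a b : ℝ, (a - b) ^ 2 ≤ 2 * (a ^ 2 + b ^ 2) := fun a b => by
    nlinarith [sq_nonneg (a + b)]
  have hmain := expect_abs_radSum_le_of_packing S (fun r j => g r (z j) - g r (z' j))
    (fun r s => (∫ x, (r x - s x) ^ 2 ∂Q) / B ^ 2) (S := 2 * √m * (G + L * B)) (D := 7 * d)
    (by positivity) (by positivity) (fun r => by simp)
    (fun r s => by
      congr 1
      exact integral_congr_ae (ae_of_all _ fun x => by ring))
    (fun r hr => by
      have h1 : ∀ j, (g r (z j) - g r (z' j)) ^ 2 ≤ 4 * G ^ 2 := fun j => by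
        have h2 := abs_le.1 (hg.bounded r (hS r hr) (z j))
        have h3 := abs_le.1 (hg.bounded r (hS r hr) (z' j))
        nlinarith
      refine (Finset.sum_le_card_nsmul _ _ _ fun j _ => h1 j).trans ?_
      rw [nsmul_eq_mul, Finset.card_univ, ← hm, mul_pow, mul_pow, Real.sq_sqrt hm0.le]
      have : G ^ 2 ≤ (G + L * B) ^ 2 := pow_le_pow_left₀ hG.le (by linarith) 2
      nlinarith)
    (fun r hr s hs => by
      have hi := hQint (fun x => (r x - s x) ^ 2)
        fun P _ => hH.integrable_sub_sq P (hS r hr) (hS s hs)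
      have h1 : ∑ j, ((g r (z j) - g r (z' j)) - (g s (z j) - g s (z' j))) ^ 2 ≤
          2 * L ^ 2 * ∑ j, (∫ x, (r x - s x) ^ 2 ∂(κ (z j)) + ∫ x, (r x - s x) ^ 2 ∂(κ (z' j))) := by
        rw [Finset.mul_sum]
        refine Finset.sum_le_sum fun j _ => ?_
        have h2 := hg.lipschitz r (hS r hr) s (hS s hs) (z j)
        have h3 := hg.lipschitz r (hS r hr) s (hS s hs) (z' j)
        have h4 := hsq (g r (z j) - g s (z j)) (g r (z' j) - g s (z' j))
        calc _ = (g r (z j) - g s (z j) - (g r (z' j) - g s (z' j))) ^ 2 := by ring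
          _ ≤ _ := by linarith
      refine h1.trans ?_
      have h5 : ∑ j, (∫ x, (r x - s x) ^ 2 ∂(κ (z j)) + ∫ x, (r x - s x) ^ 2 ∂(κ (z' j))) =
          2 * m * ∫ x, (r x - s x) ^ 2 ∂Q := by
        rw [hi]; field_simp
      rw [h5, mul_pow, mul_pow, Real.sq_sqrt hm0.le]
      have h6 : (L * B) ^ 2 ≤ (G + L * B) ^ 2 := pow_le_pow_left₀ hLB (by linarith) 2
      have h7 : 0 ≤ ∫ x, (r x - s x) ^ 2 ∂Q := integral_nonneg fun x => by positivity
      calc 2 * L ^ 2 * (2 * m * ∫ x, (r x - s x) ^ 2 ∂Q)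
          = 2 ^ 2 * m * (L * B) ^ 2 * ((∫ x, (r x - s x) ^ 2 ∂Q) / B ^ 2) := by
            field_simp
        _ ≤ _ := by gcongr)
    (fun k N hN hNne hsep =>
      log_two_mul_card_le_of_separated Q hB hH hd0 hd N (fun r hr => hS r (hN hr)) hNne k hsep)
    τ hτ
  refine hmain.trans ?_
  have h7 : √(7 * d) ≤ 45 / 17 * √d := by
    rw [Real.sqrt_mul (by norm_num)]
    gcongr
    exact Real.sqrt_le_iff.2 ⟨by norm_num, by norm_num⟩
  calc 17 / 2 * (2 * √m * (G + L * B)) * √(7 * d)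
      ≤ 17 / 2 * (2 * √m * (G + L * B)) * (45 / 17 * √d) := by gcongr
    _ = _ := by ring

lemma IsLipschitzObservable.measure_finset_deviation_le {ι Z : Type*} [Fintype ι]
    [Nonempty ι] [MeasurableSpace Z] {B : ℝ} (hB : 0 < B) {H : Set (Z → ℝ)}
    (hH : IsRewardClass B H) {d : ℕ} (hd0 : 1 ≤ d) (hd : rewardVCDim H ≤ d) {κ : Z → Measure Z}
    [∀ z, IsProbabilityMeasure (κ z)] {G L : ℝ} (hG : 0 < G) (hL : 0 ≤ L)
    {g : (Z → ℝ) → Z → ℝ} (hg : IsLipschitzObservable H κ G L g) (S : Finset (Z → ℝ))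
    (hS : ∀ r ∈ S, r ∈ H) (D : ι → Measure Z) [∀ j, IsProbabilityMeasure (D j)] {t : ℝ}
    (ht : 0 < t) :
    Measure.pi D {z | ∃ r ∈ S, t < |∑ j, g r (z j) - ∑ j, ∫ x, g r x ∂(D j)|} ≤
      ENNReal.ofReal (45 * √(Fintype.card ι) * √d * (G + L * B) / t) := by
  classical
  rcases S.eq_empty_or_nonempty with rfl | hne
  · simp
  have hE := integral_sup_deviation_le D hne g (fun r hr => hg.measurable r (hS r hr))
    (fun r hr => hg.bounded r (hS r hr))
    (fun z z' τ hτ => hg.expect_abs_radSum_le hB hH hd0 hd hG hL S hS z z' τ hτ)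
  have hFmeas : ∀ r ∈ S, Measurable fun z : ι → Z =>
      ∑ j, g r (z j) - ∑ j, ∫ x, g r x ∂(D j) := fun r hr =>
    (Finset.measurable_sum _ fun j _ =>
      (hg.measurable r (hS r hr)).comp (measurable_pi_apply j)).sub_const _
  have hFbound : ∀ r ∈ S, ∀ z : ι → Z,
      |∑ j, g r (z j) - ∑ j, ∫ x, g r x ∂(D j)| ≤ Fintype.card ι * (2 * G) := fun r hr z => by
    rw [← Finset.sum_sub_distrib]
    refine (Finset.abs_sum_le_sum_abs _ _).trans
      ((Finset.sum_le_card_nsmul _ _ (2 * G) fun j _ => ?_).trans (by simp))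
    have h3 := norm_integral_le_of_norm_le_const (μ := D j) (f := g r) (C := G)
      (ae_of_all _ fun x => hg.bounded r (hS r hr) x)
    rw [Real.norm_eq_abs] at h3
    simp only [probReal_univ, mul_one] at h3
    linarith [hg.bounded r (hS r hr) (z j), abs_sub (g r (z j)) (∫ x, g r x ∂(D j))]
  have hint := integrable_sup_abs (P := Measure.pi D) hne hFmeas hFbound
  have hmarkov := mul_meas_ge_le_integral_of_nonneg (ae_of_all _ fun z => by
    obtain ⟨r, hr⟩ := hne
    exact (abs_nonneg _).trans (Finset.le_sup'
      (fun r => |∑ j, g r (z j) - ∑ j, ∫ x, g r x ∂(D j)|) hr)) hint t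
  have hsub : {z : ι → Z | ∃ r ∈ S, t < |∑ j, g r (z j) - ∑ j, ∫ x, g r x ∂(D j)|} ⊆
      {z | t ≤ S.sup' hne fun r => |∑ j, g r (z j) - ∑ j, ∫ x, g r x ∂(D j)|} := by
    rintro z ⟨r, hr, h⟩
    exact h.le.trans (Finset.le_sup'
      (fun r => |∑ j, g r (z j) - ∑ j, ∫ x, g r x ∂(D j)|) hr)
  refine (measure_mono hsub).trans ?_
  rw [← ofReal_measureReal]
  apply ENNReal.ofReal_le_ofReal
  rw [le_div_iff₀ ht]
  linarith

/-- Uniform deviation bound for a Lipschitz observable over a class of VC-dimension at most `d`. -/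
theorem IsLipschitzObservable.measure_deviation_le {ι Z : Type*} [Fintype ι]
    [Nonempty ι] [MeasurableSpace Z] {B : ℝ} (hB : 0 < B) {H : Set (Z → ℝ)}
    (hH : IsRewardClass B H) {d : ℕ} (hd0 : 1 ≤ d) (hd : rewardVCDim H ≤ d) {κ : Z → Measure Z}
    [∀ z, IsProbabilityMeasure (κ z)] {G L : ℝ} (hG : 0 < G) (hL : 0 ≤ L)
    {g : (Z → ℝ) → Z → ℝ} (hg : IsLipschitzObservable H κ G L g)
    (D : ι → Measure Z) [∀ j, IsProbabilityMeasure (D j)] {t : ℝ} (ht : 0 < t) :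
    Measure.pi D {z | ∃ r ∈ H, t < |∑ j, g r (z j) - ∑ j, ∫ x, g r x ∂(D j)|} ≤
      ENNReal.ofReal (45 * √(Fintype.card ι) * √d * (G + L * B) / t) := by
  classical
  obtain ⟨H₀, hH₀, hcount, hdense⟩ := hH.separable
  have hne : H₀.Nonempty := by
    obtain ⟨r, hr⟩ := hH.nonempty
    obtain ⟨s, hs, -⟩ := hdense r hr
    exact ⟨s 0, hs 0⟩
  obtain ⟨e, rfl⟩ := hcount.exists_eq_range hne
  -- The strict inequality is an open condition, so a deviation above `t` in `H` already occurs in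
  -- the countable subclass, hence in an initial segment of its enumeration. The bound for finite
  -- sets does not depend on their size and passes to the increasing union.
  have hsub : {z : ι → Z | ∃ r ∈ H, t < |∑ j, g r (z j) - ∑ j, ∫ x, g r x ∂(D j)|} ⊆
      ⋃ n : ℕ, {z | ∃ r ∈ (Finset.range n).image e,
        t < |∑ j, g r (z j) - ∑ j, ∫ x, g r x ∂(D j)|} := by
    rintro z ⟨r, hr, h⟩
    obtain ⟨s, hs, hlim⟩ := hdense r hr
    have hsH : ∀ n, s n ∈ H := fun n => hH₀ (hs n)
    have hpt := hg.tendsto r hr s hsH hlim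
    have h1 : Tendsto (fun n => |∑ j, g (s n) (z j) - ∑ j, ∫ x, g (s n) x ∂(D j)|) atTop
        (𝓝 |∑ j, g r (z j) - ∑ j, ∫ x, g r x ∂(D j)|) := by
      refine ((tendsto_finsetSum _ fun j _ => hpt (z j)).sub
        (tendsto_finsetSum _ fun j _ => ?_)).abs
      exact tendsto_integral_of_dominated_convergence (fun _ => G)
        (fun n => (hg.measurable _ (hsH n)).aestronglyMeasurable) (integrable_const _)
        (fun n => ae_of_all _ fun x => hg.bounded _ (hsH n) x) (ae_of_all _ hpt)
    obtain ⟨n, hn⟩ := (h1.eventually (lt_mem_nhds h)).exists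
    obtain ⟨i, hi⟩ := hs n
    refine Set.mem_iUnion.2 ⟨i + 1, e i, Finset.mem_image_of_mem e (by simp), ?_⟩
    rw [hi]
    exact hn
  refine (measure_mono hsub).trans ?_
  rw [Monotone.measure_iUnion]
  · refine iSup_le fun n => hg.measure_finset_deviation_le hB hH hd0 hd hG hL _ ?_ D ht
    intro r hr
    obtain ⟨i, -, rfl⟩ := Finset.mem_image.1 hr
    exact hH₀ ⟨i, rfl⟩
  · rintro n n' hn z ⟨r, hr, h⟩
    exact ⟨r, Finset.image_subset_image (Finset.range_subset_range.2 hn) hr, h⟩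

lemma IsRewardClass.mono {Z : Type*} [MeasurableSpace Z] {B B' : ℝ} {H : Set (Z → ℝ)}
    (hH : IsRewardClass B H) (hB : B ≤ B') : IsRewardClass B' H :=
  ⟨hH.nonempty, hH.measurable, fun r hr z => (hH.bounded r hr z).trans hB, hH.separable⟩

/-- If `r z < s z`, the point `(z, r z)` lies in the subgraph of `s` but not of `r`, so it is
shattered. This settles `d = 0`, where the entropy bound used for chaining is unavailable. -/
lemma eq_of_rewardVCDim_le_zero {Z : Type*} {H : Set (Z → ℝ)} (hH : rewardVCDim H ≤ (0 : ℕ))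
    {r s : Z → ℝ} (hr : r ∈ H) (hs : s ∈ H) : r = s := by
  classical
  by_contra hne
  obtain ⟨z, hz⟩ := Function.ne_iff.1 hne
  wlog hlt : r z < s z generalizing r s
  · exact this hs hr (Ne.symm hne) hz.symm (lt_of_le_of_ne (not_lt.1 hlt) hz.symm)
  have hsh : ShattersFinset (subgraph '' H) {(z, r z)} := by
    intro t ht
    rcases Finset.subset_singleton_iff.1 ht with rfl | rfl
    · exact ⟨subgraph r, ⟨r, hr, rfl⟩, by simp [subgraph]⟩
    · exact ⟨subgraph s, ⟨s, hs, rfl⟩, by simpa [subgraph] using hlt⟩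
  simpa using hsh.card_le hH

lemma deviation_ratio_le {m d ε δ A : ℝ} (hm : 0 < m) (hε : 0 < ε) (hδ : 0 < δ) (hd : 0 ≤ d)
    (h : (180 * A / δ) ^ 2 * (d / ε ^ 2) ≤ m) :
    45 * √m * √d * A / (m * ε / 4) ≤ δ := by
  have h1 : 180 * A / δ * √d / ε ≤ √m := by
    apply Real.le_sqrt_of_sq_le
    rw [div_pow, mul_pow, Real.sq_sqrt hd, mul_div_assoc]
    exact h
  rw [div_le_iff₀ hε, div_mul_eq_mul_div, div_le_iff₀ hδ] at h1
  rw [div_le_iff₀ (by positivity)]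
  have h2 : √m * √m = m := Real.mul_self_sqrt hm.le
  have h3 := mul_le_mul_of_nonneg_left h1 (Real.sqrt_nonneg m)
  have h4 : √m * (√m * ε * δ) = m * ε * δ := by
    rw [← mul_assoc, ← mul_assoc, h2]
  linarith

/-- Approximate minimizers of the empirical sums of a Lipschitz observable approximately minimize
the expected sums. -/
theorem IsLipschitzObservable.measure_excess_le {ι Z : Type*} [Fintype ι]
    [Nonempty ι] [MeasurableSpace Z] {B : ℝ} (hB : 0 < B) {H : Set (Z → ℝ)}
    (hH : IsRewardClass B H) {d : ℕ} (hd : rewardVCDim H ≤ d) {κ : Z → Measure Z}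
    [∀ z, IsProbabilityMeasure (κ z)] {G L : ℝ} (hG : 0 < G) (hL : 0 ≤ L)
    {g : (Z → ℝ) → Z → ℝ} (hg : IsLipschitzObservable H κ G L g)
    (D : ι → Measure Z) [∀ j, IsProbabilityMeasure (D j)] {A ε δ : ℝ} (hε : 0 < ε) (hδ : 0 < δ)
    (hA : G + L * B ≤ A) (hm : (180 * A / δ) ^ 2 * (d / ε ^ 2) ≤ Fintype.card ι) :
    Measure.pi D {z | ∃ r' ∈ H, ∃ r ∈ H,
      ∑ j, g r' (z j) ≤ ∑ j, g r (z j) + Fintype.card ι * (ε / 2) ∧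
      ∑ j, ∫ x, g r x ∂(D j) + Fintype.card ι * ε < ∑ j, ∫ x, g r' x ∂(D j)} ≤
      ENNReal.ofReal δ := by
  have hm0 : (0 : ℝ) < Fintype.card ι := by exact_mod_cast Fintype.card_pos
  rcases Nat.eq_zero_or_pos d with rfl | hd0
  · refine (measure_mono (t := ∅) ?_).trans (by simp)
    rintro z ⟨r', hr', r, hr, -, h⟩
    rw [eq_of_rewardVCDim_le_zero hd hr hr'] at h
    have : 0 < Fintype.card ι * ε := by positivity
    linarith
  -- With `m` examples, two deviations of at most `m * ε / 4` and the optimization error `m * ε / 2`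
  -- add up to `m * ε`.
  · refine le_trans (measure_mono ?_) ((hg.measure_deviation_le hB hH hd0 hd hG hL D
      (t := Fintype.card ι * ε / 4) (by positivity)).trans (ENNReal.ofReal_le_ofReal ?_))
    · rintro z ⟨r', hr', r, hr, h1, h2⟩
      by_contra hcon
      simp only [Set.mem_ofPred_eq, not_exists, not_and, not_lt] at hcon
      have h3 := abs_le.1 (hcon r hr)
      have h4 := abs_le.1 (hcon r' hr')
      linarith
    · refine le_trans ?_ (deviation_ratio_le hm0 hε hδ (Nat.cast_nonneg d) hm)
      gcongr

lemma exists_le_add_of_bddBelow {α : Type*} {H : Set α} (hH : H.Nonempty) (F : α → ℝ) {c : ℝ}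
    (hc : ∀ r ∈ H, c ≤ F r) {η : ℝ} (hη : 0 < η) : ∃ r' ∈ H, ∀ r ∈ H, F r' ≤ F r + η := by
  have hbdd : BddBelow (F '' H) := ⟨c, by rintro _ ⟨r, hr, rfl⟩; exact hc r hr⟩
  obtain ⟨_, ⟨r', hr', rfl⟩, hlt⟩ := exists_lt_of_csInf_lt (hH.image F)
    (show sInf (F '' H) < sInf (F '' H) + η by linarith)
  refine ⟨r', hr', fun r hr => ?_⟩
  have := csInf_le hbdd ⟨r, hr, rfl⟩
  linarith

/-! ### Ranking -/

lemma isRanking_iff_eq_sortUtilities {K : ℕ} {u : Fin K → ℝ} (hu : Function.Injective u)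
    (σ : Equiv.Perm (Fin K)) : IsRanking u σ ↔ σ = sortUtilities u := by
  rw [sortUtilities, Tuple.eq_sort_iff]
  constructor
  · intro h
    refine ⟨fun i j hij => neg_le_neg (h.antitone hij), fun i j hij heq => ?_⟩
    exact absurd (σ.injective (hu (neg_injective heq))) hij.ne
  · rintro ⟨h, -⟩ i j hij
    refine lt_of_le_of_ne (neg_le_neg_iff.1 (h hij.le)) fun heq => ?_
    exact hij.ne' (σ.injective (hu heq))

/-- By independence and Fubini, it suffices that for each fixed first point the second utility hits
that one value with probability zero. -/
lemma ae_pi_utility_ne {ι Z : Type*} [Fintype ι] [MeasurableSpace Z] {U : Z → ℝ}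
    (hU : Measurable U) (D : ι → Measure Z) [∀ j, IsProbabilityMeasure (D j)]
    (hD : ∀ j, ∀ t : ℝ, D j (U ⁻¹' {t}) = 0) {i j : ι} (hij : i ≠ j) :
    ∀ᵐ z ∂(Measure.pi D), U (z i) ≠ U (z j) := by
  have hind : IndepFun (fun z : ι → Z => z i) (fun z => z j) (Measure.pi D) :=
    (iIndepFun_pi (μ := D) (X := fun _ x => x) fun _ => aemeasurable_id).indepFun hij
  have hmap := (indepFun_iff_map_prod_eq_prod_map_map (measurable_pi_apply i).aemeasurable
    (measurable_pi_apply j).aemeasurable).1 hind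
  rw [(measurePreserving_eval D i).map_eq, (measurePreserving_eval D j).map_eq] at hmap
  have hS : MeasurableSet {p : Z × Z | U p.1 = U p.2} :=
    measurableSet_eq_fun (hU.comp measurable_fst) (hU.comp measurable_snd)
  have hnull : ((D i).prod (D j)) {p : Z × Z | U p.1 = U p.2} = 0 := by
    rw [Measure.prod_apply hS]
    refine (lintegral_congr fun x => ?_).trans lintegral_zero
    convert hD j (U x) using 2
    ext y
    exact eq_comm
  rw [← hmap, Measure.map_apply ((measurable_pi_apply i).prodMk (measurable_pi_apply j)) hS]
    at hnull
  exact measure_eq_zero_iff_ae_notMem.1 hnull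

lemma ae_isRanking_iff {X : Type*} [MeasurableSpace X] {n K : ℕ} {U : X → ℝ} (hU : Measurable U)
    (D : Fin n × Fin K → Measure X) [∀ j, IsProbabilityMeasure (D j)]
    (hD : ∀ j, ∀ t : ℝ, D j (U ⁻¹' {t}) = 0) :
    ∀ᵐ z ∂(Measure.pi D), ∀ i : Fin n, ∀ σ : Equiv.Perm (Fin K),
      IsRanking (fun k => U (z (i, k))) σ ↔
        σ = sortUtilities fun k => (observe U z (i, k)).2 := by
  have h : ∀ᵐ z ∂(Measure.pi D), ∀ i : Fin n, ∀ k l : Fin K, k ≠ l →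
      U (z (i, k)) ≠ U (z (i, l)) := by
    simp only [ae_all_iff]
    intro i k l hkl
    exact ae_pi_utility_ne hU D hD fun h => hkl (Prod.ext_iff.1 h).2
  filter_upwards [h] with z hz i σ
  refine isRanking_iff_eq_sortUtilities (fun k l hkl => ?_) σ
  by_contra hne
  exact hz i k l hne hkl

/-! ### Empirical risk minimization -/

lemma IsRewardClass.nonneg_of_point {Z : Type*} [MeasurableSpace Z] {B : ℝ} {H : Set (Z → ℝ)}
    (hH : IsRewardClass B H) (z : Z) : 0 ≤ B := by
  obtain ⟨r, hr⟩ := hH.nonempty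
  exact (abs_nonneg _).trans (hH.bounded r hr z)

lemma IsLoss.exists_isApproxERM {ι Z : Type*} [Fintype ι] [MeasurableSpace Z] {B : ℝ} {Λ : ℝ≥0}
    {ℓ : ℝ → ℝ → ℝ} (hℓ : IsLoss B Λ ℓ) {H : Set (Z → ℝ)} (hH : IsRewardClass B H) {η : ℝ}
    (hη : 0 < η) (data : ι → Z × ℝ) : ∃ r', IsApproxERM ℓ H η data r' := by
  have h1 : ∀ j, ∃ c, ∀ v ∈ Icc (-B) B, ‖ℓ v (data j).2‖ ≤ c := fun j =>
    isCompact_Icc.exists_bound_of_continuousOn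
      (hℓ.continuous.comp (continuous_id.prodMk continuous_const)).continuousOn
  choose c hc using h1
  refine exists_le_add_of_bddBelow hH.nonempty (empiricalLoss ℓ data)
    (c := (∑ j, -c j) / Fintype.card ι) (fun r hr => ?_) hη
  refine div_le_div_of_nonneg_right (Finset.sum_le_sum fun j _ => ?_) (Nat.cast_nonneg _)
  exact (abs_le.1 (hc j _ (abs_le.1 (hH.bounded r hr _)))).1

/-- Subtracting `ℓ 0 (U z)` leaves loss comparisons unchanged and makes the bound depend on `Λ` and
`B` alone, not on the size of `ℓ`. The `+ 1` keeps it positive when `Λ * |B|` vanishes. -/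
lemma IsLoss.isLipschitzObservable {Z : Type*} [MeasurableSpace Z] {B : ℝ} {Λ : ℝ≥0}
    {ℓ : ℝ → ℝ → ℝ} (hℓ : IsLoss B Λ ℓ) {H : Set (Z → ℝ)} (hH : IsRewardClass B H) {U : Z → ℝ}
    (hU : Measurable U) (hU1 : ∀ z, U z ∈ Icc (0 : ℝ) 1) :
    IsLipschitzObservable H Measure.dirac (Λ * |B| + 1) Λ
      fun r z => ℓ (r z) (U z) - ℓ 0 (U z) where
  measurable r hr := by
    have h1 := hℓ.continuous.measurable
    exact (h1.comp ((hH.measurable r hr).prodMk hU)).sub (h1.comp (measurable_const.prodMk hU))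
  bounded r hr z := by
    have hB := hH.nonneg_of_point z
    have h := (hℓ.lipschitz (U z) (hU1 z)).dist_le_mul (r z) (abs_le.1 (hH.bounded r hr z)) 0
      ⟨by linarith, hB⟩
    rw [Real.dist_eq, Real.dist_eq, sub_zero] at h
    have h2 : (Λ : ℝ) * |r z| ≤ Λ * |B| :=
      mul_le_mul_of_nonneg_left ((hH.bounded r hr z).trans (le_abs_self B)) Λ.coe_nonneg
    linarith
  lipschitz r hr s hs z := by
    have h := (hℓ.lipschitz (U z) (hU1 z)).dist_le_mul (r z) (abs_le.1 (hH.bounded r hr z)) (s z)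
      (abs_le.1 (hH.bounded s hs z))
    rw [Real.dist_eq, Real.dist_eq] at h
    have hm : Measurable fun x => (r x - s x) ^ 2 :=
      ((hH.measurable r hr).sub (hH.measurable s hs)).pow_const 2
    rw [integral_dirac' _ _ hm.stronglyMeasurable, ← mul_pow]
    refine sq_le_sq.2 ?_
    rw [abs_mul, NNReal.abs_eq]
    simpa using h
  tendsto r _ s _ hlim z :=
    (((hℓ.continuous.comp (continuous_id.prodMk continuous_const)).tendsto (r z)).comp
      (hlim z)).sub_const _

lemma IsLoss.measure_excess_loss_le {ι Z : Type*} [Fintype ι] [Nonempty ι] [MeasurableSpace Z]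
    {B : ℝ} {Λ : ℝ≥0} {ℓ : ℝ → ℝ → ℝ} (hℓ : IsLoss B Λ ℓ) {H : Set (Z → ℝ)}
    (hH : IsRewardClass B H) {d : ℕ} (hd : rewardVCDim H ≤ d) {U : Z → ℝ} (hU : Measurable U)
    (hU1 : ∀ z, U z ∈ Icc (0 : ℝ) 1) (D : ι → Measure Z) [∀ j, IsProbabilityMeasure (D j)]
    {A ε δ : ℝ} (hε : 0 < ε) (hδ : 0 < δ) (hA : Λ * |B| + 1 + Λ * (|B| + 1) ≤ A)
    (hm : (180 * A / δ) ^ 2 * (d / ε ^ 2) ≤ Fintype.card ι) :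
    Measure.pi D {z | ∃ r', IsApproxERM ℓ H (ε / 2) (observe U z) r' ∧
      ∃ r ∈ H, populationLoss ℓ U D r + ε < populationLoss ℓ U D r'} ≤ ENNReal.ofReal δ := by
  have hm0 : (0 : ℝ) < Fintype.card ι := by exact_mod_cast Fintype.card_pos
  have hg := hℓ.isLipschitzObservable hH hU hU1
  -- The radius `|B| + 1` is positive for every real `B`, as the entropy bound requires.
  refine (measure_mono ?_).trans (hg.measure_excess_le (by positivity)
    (hH.mono ((le_abs_self B).trans (by linarith : |B| ≤ |B| + 1))) hd (by positivity)
    Λ.coe_nonneg D hε hδ hA hm)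
  obtain ⟨c, hc⟩ := (isCompact_Icc (a := (0 : ℝ)) (b := 1)).exists_bound_of_continuousOn
    (f := fun u => ℓ 0 u) (hℓ.continuous.comp (continuous_const.prodMk continuous_id)).continuousOn
  have h0 : ∀ j, Integrable (fun z => ℓ 0 (U z)) (D j) := fun j =>
    Integrable.of_bound (hℓ.continuous.measurable.comp
      (measurable_const.prodMk hU)).aestronglyMeasurable c (ae_of_all _ fun z => hc _ (hU1 z))
  have hpop : ∀ r ∈ H, populationLoss ℓ U D r * Fintype.card ι =
      ∑ j, ∫ z, (ℓ (r z) (U z) - ℓ 0 (U z)) ∂(D j) + ∑ j, ∫ z, ℓ 0 (U z) ∂(D j) := by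
    intro r hr
    rw [populationLoss, div_mul_cancel₀ _ hm0.ne', ← Finset.sum_add_distrib]
    refine Finset.sum_congr rfl fun j _ => ?_
    rw [← integral_add _ (h0 j)]
    · simp
    · exact Integrable.of_bound (hg.measurable r hr).aestronglyMeasurable _
        (ae_of_all _ fun z => hg.bounded r hr z)
  have hemp : ∀ (z : ι → Z) r, empiricalLoss ℓ (observe U z) r * Fintype.card ι =
      ∑ j, (ℓ (r (z j)) (U (z j)) - ℓ 0 (U (z j))) + ∑ j, ℓ 0 (U (z j)) := by
    intro z r
    rw [empiricalLoss, div_mul_cancel₀ _ hm0.ne', ← Finset.sum_add_distrib]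
    exact Finset.sum_congr rfl fun j _ => by simp [observe]
  rintro z ⟨r', ⟨hr', herm⟩, r, hr, hlt⟩
  refine ⟨r', hr', r, hr, ?_, ?_⟩
  · have h1 := mul_le_mul_of_nonneg_right (herm r hr) hm0.le
    rw [add_mul, hemp, hemp] at h1
    linarith
  · have h1 := mul_lt_mul_of_pos_right hlt hm0
    rw [add_mul, hpop r hr, hpop r' hr'] at h1
    linarith

/-! ### Induced policies -/

/-- The density of the policy induced by `r` with respect to the reference policy. -/
noncomputable def policyDensity {X Y : Type*} [MeasurableSpace X] [MeasurableSpace Y] (πref : Kernel X Y) (β : ℝ)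
    (r : X × Y → ℝ) (z : X × Y) : ℝ :=
  Real.exp (r z / β) / ∫ y, Real.exp (r (z.1, y) / β) ∂(πref z.1)

/-- The law that puts half its mass on `z = (x, y)` and the other half on `x` together with a
random draw from the reference policy. -/
noncomputable def resampledLaw {X Y : Type*} [MeasurableSpace X] [MeasurableSpace Y] (πref : Kernel X Y)
    (z : X × Y) : Measure (X × Y) :=
  (2⁻¹ : ℝ≥0∞) • (Measure.dirac z + (πref z.1).map (Prod.mk z.1))

instance {X Y : Type*} [MeasurableSpace X] [MeasurableSpace Y] (πref : Kernel X Y)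
    [IsMarkovKernel πref] (z : X × Y) : IsProbabilityMeasure (resampledLaw πref z) := by
  have := Measure.isProbabilityMeasure_map (μ := πref z.1)
    (measurable_prodMk_left (x := z.1)).aemeasurable
  constructor
  rw [resampledLaw, Measure.smul_apply, Measure.add_apply, measure_univ, measure_univ, smul_eq_mul,
    one_add_one_eq_two, ENNReal.inv_mul_cancel (by norm_num) (by norm_num)]

lemma integral_resampledLaw {X Y : Type*} [MeasurableSpace X] [MeasurableSpace Y]
    (πref : Kernel X Y) [IsMarkovKernel πref] {f : X × Y → ℝ} (hf : Measurable f) {C : ℝ}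
    (hC : ∀ z, |f z| ≤ C) (z : X × Y) :
    ∫ x, f x ∂(resampledLaw πref z) = (f z + ∫ y, f (z.1, y) ∂(πref z.1)) / 2 := by
  have := Measure.isProbabilityMeasure_map (μ := πref z.1)
    (measurable_prodMk_left (x := z.1)).aemeasurable
  have hi : ∀ P : Measure (X × Y), IsFiniteMeasure P → Integrable f P := fun P _ =>
    Integrable.of_bound hf.aestronglyMeasurable C (ae_of_all _ hC)
  rw [resampledLaw, integral_smul_measure, integral_add_measure (hi _ inferInstance)
    (hi _ inferInstance), integral_dirac' _ _ hf.stronglyMeasurable,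
    integral_map measurable_prodMk_left.aemeasurable hf.aestronglyMeasurable]
  rw [ENNReal.toReal_inv, ENNReal.toReal_ofNat, smul_eq_mul]
  ring

lemma sq_integral_le_integral_sq {Ω : Type*} [MeasurableSpace Ω] (P : Measure Ω)
    [IsProbabilityMeasure P] {f : Ω → ℝ} (hf : Measurable f) {C : ℝ} (hC : ∀ ω, |f ω| ≤ C) :
    (∫ ω, f ω ∂P) ^ 2 ≤ ∫ ω, f ω ^ 2 ∂P := by
  have hi : Integrable f P := Integrable.of_bound hf.aestronglyMeasurable C (ae_of_all _ hC)
  have hi2 : Integrable (fun ω => f ω ^ 2) P :=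
    Integrable.of_bound (hf.pow_const 2).aestronglyMeasurable (C ^ 2) (ae_of_all _ fun ω => by
      rw [Real.norm_of_nonneg (by positivity), ← sq_abs]
      exact pow_le_pow_left₀ (abs_nonneg _) (hC ω) 2)
  set c := ∫ ω, f ω ∂P with hc
  have h1 : 0 ≤ ∫ ω, (f ω - c) ^ 2 ∂P := integral_nonneg fun ω => by positivity
  have h2 : ∫ ω, (f ω - c) ^ 2 ∂P = ∫ ω, f ω ^ 2 ∂P - c ^ 2 := by
    have h3 : ∀ ω, (f ω - c) ^ 2 = f ω ^ 2 - 2 * c * f ω + c ^ 2 := fun ω => by ring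
    simp_rw [h3]
    have h4 : Integrable (fun ω => f ω ^ 2 - 2 * c * f ω) P := hi2.sub (hi.const_mul _)
    rw [integral_add h4 (integrable_const _),
      integral_sub hi2 (hi.const_mul _), integral_const_mul, ← hc]
    simp
    ring
  linarith

lemma abs_exp_sub_exp_le {a b M : ℝ} (ha : a ≤ M) (hb : b ≤ M) :
    |Real.exp a - Real.exp b| ≤ Real.exp M * |a - b| := by
  wlog hab : b ≤ a generalizing a b
  · rw [abs_sub_comm, abs_sub_comm a]
    exact this hb ha (le_of_not_ge hab)
  rw [abs_of_nonneg (sub_nonneg.2 (Real.exp_le_exp.2 hab)), abs_of_nonneg (sub_nonneg.2 hab)]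
  have h1 : Real.exp a * (1 + (b - a)) ≤ Real.exp b := by
    have h2 := mul_le_mul_of_nonneg_left (Real.add_one_le_exp (b - a)) (Real.exp_pos a).le
    rw [← Real.exp_add, add_sub_cancel] at h2
    linarith
  have h3 := mul_le_mul_of_nonneg_right (Real.exp_le_exp.2 ha) (sub_nonneg.2 hab)
  linarith

section Policy

variable {X Y : Type*} [MeasurableSpace X] [MeasurableSpace Y] {B β : ℝ} {H : Set (X × Y → ℝ)}
  {r s : X × Y → ℝ}

lemma IsRewardClass.measurable_exp (hH : IsRewardClass B H) (hr : r ∈ H) :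
    Measurable fun z => Real.exp (r z / β) :=
  Real.measurable_exp.comp ((hH.measurable r hr).div_const β)

lemma IsRewardClass.exp_mem (hH : IsRewardClass B H) (hβ : 0 < β) (hr : r ∈ H) (z : X × Y) :
    Real.exp (r z / β) ∈ Icc (Real.exp (-(B / β))) (Real.exp (B / β)) := by
  have h := abs_le.1 (hH.bounded r hr z)
  constructor <;> apply Real.exp_le_exp.2
  · rw [← neg_div]; exact div_le_div_of_nonneg_right h.1 hβ.le
  · exact div_le_div_of_nonneg_right h.2 hβ.le

lemma IsRewardClass.integrable_exp (hH : IsRewardClass B H) (hβ : 0 < β) (hr : r ∈ H)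
    (x : X) (P : Measure Y) [IsFiniteMeasure P] :
    Integrable (fun y => Real.exp (r (x, y) / β)) P :=
  Integrable.of_bound ((hH.measurable_exp hr).comp measurable_prodMk_left).aestronglyMeasurable
    (Real.exp (B / β)) (ae_of_all _ fun y => by
      rw [Real.norm_of_nonneg (Real.exp_pos _).le]
      exact (hH.exp_mem hβ hr (x, y)).2)

variable (πref : Kernel X Y) [IsMarkovKernel πref]

lemma IsRewardClass.le_partition (hH : IsRewardClass B H) (hβ : 0 < β) (hr : r ∈ H) (x : X) :
    Real.exp (-(B / β)) ≤ ∫ y, Real.exp (r (x, y) / β) ∂(πref x) := by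
  have h := integral_mono (μ := πref x) (integrable_const _) (hH.integrable_exp hβ hr x _)
    fun y => (hH.exp_mem hβ hr (x, y)).1
  simpa using h

lemma IsRewardClass.measurable_policyDensity (hH : IsRewardClass B H) (hr : r ∈ H) :
    Measurable (policyDensity πref β r) := by
  refine (hH.measurable_exp hr).div ?_
  have h := StronglyMeasurable.integral_kernel_prod_right (κ := πref)
    (f := fun x y => Real.exp (r (x, y) / β)) (hH.measurable_exp hr).stronglyMeasurable
  exact h.measurable.comp measurable_fst

lemma IsRewardClass.abs_policyDensity_le (hH : IsRewardClass B H) (hβ : 0 < β) (hr : r ∈ H)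
    (z : X × Y) : |policyDensity πref β r z| ≤ Real.exp (B / β) ^ 2 := by
  have h1 := hH.le_partition πref hβ hr z.1
  have h2 := hH.exp_mem hβ hr z
  have h3 := Real.exp_pos (-(B / β))
  rw [policyDensity, abs_of_nonneg (div_nonneg (Real.exp_pos _).le (h3.le.trans h1))]
  rw [div_le_iff₀ (h3.trans_le h1)]
  calc Real.exp (r z / β) ≤ Real.exp (B / β) := h2.2
    _ = Real.exp (B / β) ^ 2 * Real.exp (-(B / β)) := by
        rw [← Real.exp_nat_mul, ← Real.exp_add]; ring_nf
    _ ≤ _ := by gcongr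

/-- Numerator and normalizing integral are both Lipschitz in the reward with constant `E / β`, the
latter in `L²` of the reference policy by `sq_integral_le_integral_sq`. The quotient rule multiplies
each difference by a weight of at most `E ^ 3`. -/
lemma IsRewardClass.sq_policyDensity_sub_le (hH : IsRewardClass B H) (hβ : 0 < β) (hr : r ∈ H)
    (hs : s ∈ H) (z : X × Y) :
    (policyDensity πref β r z - policyDensity πref β s z) ^ 2 ≤
      (2 * Real.exp (B / β) ^ 4 / β) ^ 2 * ∫ x, (r x - s x) ^ 2 ∂(resampledLaw πref z) := by
  have hB := hH.nonneg_of_point z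
  set E := Real.exp (B / β) with hE
  have hE1 : 1 ≤ E := Real.one_le_exp (by positivity)
  have hE0 : 0 < E := Real.exp_pos _
  have hEinv : Real.exp (-(B / β)) = E⁻¹ := Real.exp_neg _
  have hlip : ∀ w, (Real.exp (r w / β) - Real.exp (s w / β)) ^ 2 ≤
      (E / β) ^ 2 * (r w - s w) ^ 2 := fun w => by
    rw [← mul_pow]
    refine sq_le_sq.2 ?_
    have h := abs_exp_sub_exp_le (a := r w / β) (b := s w / β) (M := B / β)
      (div_le_div_of_nonneg_right (abs_le.1 (hH.bounded r hr w)).2 hβ.le)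
      (div_le_div_of_nonneg_right (abs_le.1 (hH.bounded s hs w)).2 hβ.le)
    refine h.trans (le_of_eq ?_)
    rw [← sub_div, abs_div, abs_mul, abs_div, abs_of_pos hβ, abs_of_pos hE0]
    ring
  have hmeas : Measurable fun w => (r w - s w) ^ 2 :=
    ((hH.measurable r hr).sub (hH.measurable s hs)).pow_const 2
  have hbd : ∀ w, |(r w - s w) ^ 2| ≤ (2 * B) ^ 2 := fun w => by
    have h1 := abs_le.1 (hH.bounded r hr w)
    have h2 := abs_le.1 (hH.bounded s hs w)
    rw [abs_of_nonneg (by positivity)]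
    exact sq_le_sq' (by linarith) (by linarith)
  set a := Real.exp (r z / β) with ha
  set b := Real.exp (s z / β) with hb
  set Zr := ∫ y, Real.exp (r (z.1, y) / β) ∂(πref z.1) with hZr
  set Zs := ∫ y, Real.exp (s (z.1, y) / β) ∂(πref z.1) with hZs
  set I := ∫ y, (r (z.1, y) - s (z.1, y)) ^ 2 ∂(πref z.1) with hI
  have hZr1 : E⁻¹ ≤ Zr := hEinv ▸ hH.le_partition πref hβ hr z.1
  have hZs1 : E⁻¹ ≤ Zs := hEinv ▸ hH.le_partition πref hβ hs z.1
  have hZr0 : 0 < Zr := (inv_pos.2 hE0).trans_le hZr1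
  have hZs0 : 0 < Zs := (inv_pos.2 hE0).trans_le hZs1
  have hbE : b ≤ E := (hH.exp_mem hβ hs z).2
  have hb0 : 0 < b := Real.exp_pos _
  have hZ : (Zr - Zs) ^ 2 ≤ (E / β) ^ 2 * I := by
    have hdiff : Zr - Zs = ∫ y, (Real.exp (r (z.1, y) / β) - Real.exp (s (z.1, y) / β)) ∂(πref z.1) :=
      (integral_sub (hH.integrable_exp hβ hr _ _) (hH.integrable_exp hβ hs _ _)).symm
    have hm : Measurable fun y => Real.exp (r (z.1, y) / β) - Real.exp (s (z.1, y) / β) :=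
      ((hH.measurable_exp hr).comp measurable_prodMk_left).sub
        ((hH.measurable_exp hs).comp measurable_prodMk_left)
    have hbb : ∀ y, |Real.exp (r (z.1, y) / β) - Real.exp (s (z.1, y) / β)| ≤ E := fun y => by
      have h1 := (hH.exp_mem hβ hr (z.1, y)).2
      have h2 := (hH.exp_mem hβ hs (z.1, y)).2
      rw [abs_le]
      constructor <;> linarith [Real.exp_pos (r (z.1, y) / β), Real.exp_pos (s (z.1, y) / β)]
    rw [hdiff]
    refine (sq_integral_le_integral_sq _ hm hbb).trans ?_
    rw [hI, ← integral_const_mul]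
    refine integral_mono_of_nonneg (ae_of_all _ fun y => by positivity) ?_
      (ae_of_all _ fun y => hlip (z.1, y))
    exact (Integrable.of_bound (hmeas.comp measurable_prodMk_left).aestronglyMeasurable
      ((2 * B) ^ 2) (ae_of_all _ fun y => hbd _)).const_mul _
  rw [integral_resampledLaw πref hmeas hbd z, ← hI]
  have hsplit : policyDensity πref β r z - policyDensity πref β s z =
      (a - b) * Zr⁻¹ - (Zr - Zs) * (b * (Zr⁻¹ * Zs⁻¹)) := by
    simp only [policyDensity, ← ha, ← hb, ← hZr, ← hZs]
    field_simp
    ring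
  have hu : Zr⁻¹ ≤ E := by rw [← inv_inv E]; exact inv_anti₀ (inv_pos.2 hE0) hZr1
  have hv : Zs⁻¹ ≤ E := by rw [← inv_inv E]; exact inv_anti₀ (inv_pos.2 hE0) hZs1
  have hu3 : Zr⁻¹ ≤ E ^ 3 := hu.trans (le_self_pow₀ hE1 (by norm_num))
  have hbuv : b * (Zr⁻¹ * Zs⁻¹) ≤ E ^ 3 := by
    calc b * (Zr⁻¹ * Zs⁻¹) ≤ E * (E * E) := by gcongr
      _ = E ^ 3 := by ring
  have h1 : ((a - b) * Zr⁻¹) ^ 2 ≤ (E / β) ^ 2 * (r z - s z) ^ 2 * (E ^ 3) ^ 2 := by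
    rw [mul_pow]
    have := hlip z
    gcongr
  have h2 : ((Zr - Zs) * (b * (Zr⁻¹ * Zs⁻¹))) ^ 2 ≤ (E / β) ^ 2 * I * (E ^ 3) ^ 2 := by
    rw [mul_pow]
    gcongr
  rw [hsplit]
  calc ((a - b) * Zr⁻¹ - (Zr - Zs) * (b * (Zr⁻¹ * Zs⁻¹))) ^ 2
      ≤ 2 * (((a - b) * Zr⁻¹) ^ 2 + ((Zr - Zs) * (b * (Zr⁻¹ * Zs⁻¹))) ^ 2) := by
        nlinarith [sq_nonneg ((a - b) * Zr⁻¹ + (Zr - Zs) * (b * (Zr⁻¹ * Zs⁻¹)))]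
    _ ≤ 2 * ((E / β) ^ 2 * (r z - s z) ^ 2 * (E ^ 3) ^ 2 + (E / β) ^ 2 * I * (E ^ 3) ^ 2) := by
        linarith
    _ = _ := by ring

lemma IsRewardClass.tendsto_policyDensity (hH : IsRewardClass B H) (hβ : 0 < β) (hr : r ∈ H)
    {f : ℕ → X × Y → ℝ} (hf : ∀ t, f t ∈ H)
    (hlim : ∀ z, Tendsto (fun t => f t z) atTop (𝓝 (r z))) (z : X × Y) :
    Tendsto (fun t => policyDensity πref β (f t) z) atTop (𝓝 (policyDensity πref β r z)) := by
  have hexp : ∀ w, Tendsto (fun t => Real.exp (f t w / β)) atTop (𝓝 (Real.exp (r w / β))) :=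
    fun w => (Real.continuous_exp.tendsto _).comp ((hlim w).div_const β)
  refine (hexp z).div ?_ ((Real.exp_pos _).trans_le (hH.le_partition πref hβ hr z.1)).ne'
  exact tendsto_integral_of_dominated_convergence (fun _ => Real.exp (B / β))
    (fun t => (hH.integrable_exp hβ (hf t) z.1 _).aestronglyMeasurable) (integrable_const _)
    (fun t => ae_of_all _ fun y => by
      rw [Real.norm_of_nonneg (Real.exp_pos _).le]
      exact (hH.exp_mem hβ (hf t) (z.1, y)).2) (ae_of_all _ fun y => hexp _)

lemma IsRewardClass.isLipschitzObservable_policy (hH : IsRewardClass B H) (hβ : 0 < β)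
    {U : X × Y → ℝ} (hU : Measurable U) (hU1 : ∀ z, U z ∈ Icc (0 : ℝ) 1) :
    IsLipschitzObservable H (resampledLaw πref) (Real.exp (B / β) ^ 2)
      (2 * Real.exp (B / β) ^ 4 / β) fun r z => -(U z * policyDensity πref β r z) where
  measurable r hr := (hU.mul (hH.measurable_policyDensity πref hr)).neg
  bounded r hr z := by
    rw [abs_neg, abs_mul, abs_of_nonneg (hU1 z).1]
    exact (mul_le_of_le_one_left (abs_nonneg _) (hU1 z).2).trans
      (hH.abs_policyDensity_le πref hβ hr z)
  lipschitz r hr s hs z := by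
    refine le_trans ?_ (hH.sq_policyDensity_sub_le πref hβ hr hs z)
    have h1 : U z ^ 2 ≤ 1 := pow_le_one₀ (hU1 z).1 (hU1 z).2
    calc _ = U z ^ 2 * (policyDensity πref β r z - policyDensity πref β s z) ^ 2 := by ring
      _ ≤ _ := mul_le_of_le_one_left (by positivity) h1
  tendsto r hr f hf hlim z := ((hH.tendsto_policyDensity πref hβ hr hf hlim z).const_mul _).neg

/-- Importance weighting: the density turns an expectation under the induced policy into one under
the law of the observed examples. The signs turn maximization of utility into minimization. -/
lemma IsRewardClass.expectedUtility_mul_card {ι : Type*} [Fintype ι] [Nonempty ι]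
    (hH : IsRewardClass B H) (hβ : 0 < β) (hr : r ∈ H) {U : X × Y → ℝ} (hU : Measurable U)
    (hU1 : ∀ z, U z ∈ Icc (0 : ℝ) 1) (μ : ι → Measure X) [∀ j, IsProbabilityMeasure (μ j)] :
    expectedUtility πref β U μ r * Fintype.card ι =
      -∑ j, ∫ z, -(U z * policyDensity πref β r z) ∂(μ j ⊗ₘ πref) := by
  have hm0 : (Fintype.card ι : ℝ) ≠ 0 := by exact_mod_cast Fintype.card_ne_zero
  have hg := hH.isLipschitzObservable_policy πref hβ hU hU1
  rw [expectedUtility, div_mul_cancel₀ _ hm0, ← Finset.sum_neg_distrib]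
  refine Finset.sum_congr rfl fun j _ => ?_
  rw [Measure.integral_compProd (Integrable.of_bound (hg.measurable r hr).aestronglyMeasurable _
    (ae_of_all _ fun z => hg.bounded r hr z))]
  simp only [integral_neg, neg_neg]
  refine integral_congr_ae (ae_of_all _ fun x => ?_)
  simp only [inducedPolicy, integral_tilted, policyDensity, smul_eq_mul]
  exact integral_congr_ae (ae_of_all _ fun y => by ring)

lemma IsRewardClass.exists_policy_learner {ι : Type*} [Fintype ι] [Nonempty ι]
    (hH : IsRewardClass B H) {d : ℕ} (hd : rewardVCDim H ≤ d) (hβ : 0 < β) {A ε δ : ℝ}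
    (hε : 0 < ε) (hδ : 0 < δ)
    (hA : Real.exp (B / β) ^ 2 + 2 * Real.exp (B / β) ^ 4 / β * (|B| + 1) ≤ A)
    (hm : (180 * A / δ) ^ 2 * (d / ε ^ 2) ≤ Fintype.card ι) :
    ∃ learner : (ι → (X × Y) × ℝ) → (X × Y → ℝ), (∀ data, learner data ∈ H) ∧
      ∀ U : X × Y → ℝ, Measurable U → (∀ z, U z ∈ Icc (0 : ℝ) 1) →
      ∀ μ : ι → Measure X, (∀ j, IsProbabilityMeasure (μ j)) →
      Measure.pi (fun j => (μ j) ⊗ₘ πref)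
        {z | ∃ r ∈ H, expectedUtility πref β U μ (learner (observe U z)) + ε <
          expectedUtility πref β U μ r} ≤ ENNReal.ofReal δ := by
  have hm0 : (0 : ℝ) < Fintype.card ι := by exact_mod_cast Fintype.card_pos
  -- The learner nearly maximizes the importance-weighted average of the labels. It uses `πref` and
  -- the data, but neither `U` nor `μ`.
  have hex : ∀ data : ι → (X × Y) × ℝ, ∃ r' ∈ H, ∀ r ∈ H,
      ∑ j, -((data j).2 * policyDensity πref β r' (data j).1) ≤
        ∑ j, -((data j).2 * policyDensity πref β r (data j).1) + Fintype.card ι * (ε / 2) := by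
    intro data
    refine exists_le_add_of_bddBelow hH.nonempty
      (fun r => ∑ j, -((data j).2 * policyDensity πref β r (data j).1))
      (c := ∑ j, -(|(data j).2| * Real.exp (B / β) ^ 2)) (fun r hr => ?_) (by positivity)
    refine Finset.sum_le_sum fun j _ => neg_le_neg ?_
    refine (le_abs_self _).trans ?_
    rw [abs_mul]
    exact mul_le_mul_of_nonneg_left (hH.abs_policyDensity_le πref hβ hr _) (abs_nonneg _)
  choose learner hlearner hopt using hex
  refine ⟨learner, hlearner, fun U hU hU1 μ hμ => ?_⟩
  have hg := hH.isLipschitzObservable_policy πref hβ hU hU1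
  refine (measure_mono ?_).trans (hg.measure_excess_le (by positivity)
    (hH.mono ((le_abs_self B).trans (by linarith : |B| ≤ |B| + 1))) hd (by positivity)
    (by positivity) (fun j => μ j ⊗ₘ πref) hε hδ hA hm)
  rintro z ⟨r, hr, hlt⟩
  refine ⟨_, hlearner (observe U z), r, hr, hopt (observe U z) r hr, ?_⟩
  have h1 := mul_lt_mul_of_pos_right hlt hm0
  rw [add_mul, hH.expectedUtility_mul_card πref hβ hr hU hU1,
    hH.expectedUtility_mul_card πref hβ (hlearner _) hU hU1] at h1
  linarith

end Policy

/-! ### The sample size -/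

lemma exists_sample_size {c : ℝ} (hc : 0 ≤ c) (N K d : ℕ) (ε : ℝ) (hN : 0 < N) (hK : 0 < K) :
    ∃ n₀ : ℕ, N ≤ n₀ ∧ (n₀ * K : ℝ) ≤ (c + 1) * (N * K + d / ε ^ 2) ∧
      ((c + 1) * (d / ε ^ 2) ≤ N * K → n₀ = N) ∧
      ∀ n : ℕ, n₀ ≤ n → c * (d / ε ^ 2) ≤ n * K := by
  have hK0 : (0 : ℝ) < K := by exact_mod_cast hK
  set q : ℝ := d / ε ^ 2 with hq
  have hq0 : 0 ≤ q := by positivity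
  have hN0 : (0 : ℝ) ≤ N := N.cast_nonneg
  have hNK : 0 ≤ (N : ℝ) * K := by positivity
  have hcq : 0 ≤ c * q := by positivity
  have hcNK : 0 ≤ c * (N * K) := by positivity
  rcases le_or_gt (c * q) (N * K) with h | h
  · refine ⟨N, le_rfl, by nlinarith, fun _ => rfl, fun n hn => h.trans ?_⟩
    gcongr
  -- Rounding up to whole problems costs at most `K ≤ N * K` observations, which the `+ 1` in the
  -- constant absorbs.
  · have hceil := Nat.le_ceil (c * q / K)
    rw [div_le_iff₀ hK0] at hceil
    have hceil' := Nat.ceil_lt_add_one (a := c * q / K) (by positivity)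
    have hlt : (N : ℝ) < ⌈c * q / K⌉₊ := by
      have : (N : ℝ) * K < ⌈c * q / K⌉₊ * K := h.trans_le hceil
      exact lt_of_mul_lt_mul_right this hK0.le
    have hlt' : N < ⌈c * q / K⌉₊ := by exact_mod_cast hlt
    refine ⟨⌈c * q / K⌉₊, hlt'.le, ?_, fun h' => absurd h (not_lt.2 (by linarith)), fun n hn => ?_⟩
    · have h1 : (⌈c * q / K⌉₊ : ℝ) * K ≤ c * q + K := by
        have := mul_le_mul_of_nonneg_right hceil'.le hK0.le
        rwa [add_mul, div_mul_cancel₀ _ hK0.ne', one_mul] at this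
      have h2 : (K : ℝ) ≤ N * K := le_mul_of_one_le_left hK0.le (by exact_mod_cast hN)
      linarith
    · refine hceil.trans ?_
      gcongr

theorem theorem3p1 (δ : ℝ) (hδ : 0 < δ) (β : ℝ) (hβ : 0 < β) (B : ℝ) (Λ : ℝ≥0) :
    ∃ C : ℝ, 0 < C ∧
      ∀ (N K d : ℕ) (ε : ℝ), 0 < N → 0 < K → 0 < ε →
        -- `n₀ * K` utility observations are enough, for `n₀` problems with `K` chains each
        ∃ n₀ : ℕ, N ≤ n₀ ∧ (n₀ * K : ℝ) ≤ C * (N * K + d / ε ^ 2) ∧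
          (C * (d / ε ^ 2) ≤ N * K → n₀ = N) ∧
          ∀ n : ℕ, n₀ ≤ n →
            ∀ (X : Type u) (Y : Type v) [MeasurableSpace X] [MeasurableSpace Y]
              (H : Set (X × Y → ℝ)), IsRewardClass B H → rewardVCDim H ≤ d →
              -- `D (i, k)` is the law of the `k`-th problem-chain pair of problem `i`; it may be
              -- concentrated on one given problem `x i`, or be the same law for all `(i, k)`.
              -- The ranking of the chains of every problem is recovered by sorting:
              (∀ U : X × Y → ℝ, Measurable U → (∀ z, U z ∈ Icc (0 : ℝ) 1) →
                ∀ D : Fin n × Fin K → Measure (X × Y), (∀ j, IsProbabilityMeasure (D j)) →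
                (∀ j, ∀ t : ℝ, D j (U ⁻¹' {t}) = 0) →
                ∀ᵐ z ∂(Measure.pi D), ∀ i : Fin n, ∀ σ : Equiv.Perm (Fin K),
                  IsRanking (fun k => U (z (i, k))) σ ↔
                    σ = sortUtilities fun k => (observe U z (i, k)).2) ∧
              -- empirical risk minimization on the labelled examples has excess loss at most `ε`
              (∀ ℓ : ℝ → ℝ → ℝ, IsLoss B Λ ℓ →
                (∀ data : Fin n × Fin K → (X × Y) × ℝ, ∃ r', IsApproxERM ℓ H (ε / 2) data r') ∧
                ∀ U : X × Y → ℝ, Measurable U → (∀ z, U z ∈ Icc (0 : ℝ) 1) →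
                ∀ D : Fin n × Fin K → Measure (X × Y), (∀ j, IsProbabilityMeasure (D j)) →
                Measure.pi D {z | ∃ r', IsApproxERM ℓ H (ε / 2) (observe U z) r' ∧
                    ∃ r ∈ H, populationLoss ℓ U D r + ε < populationLoss ℓ U D r'}
                  ≤ ENNReal.ofReal δ) ∧
              -- a reward whose induced policy has `ε`-suboptimal expected utility is learned
              (∀ (πref : Kernel X Y) [IsMarkovKernel πref],
                ∃ learner : (Fin n × Fin K → (X × Y) × ℝ) → (X × Y → ℝ),
                  (∀ data, learner data ∈ H) ∧
                  ∀ U : X × Y → ℝ, Measurable U → (∀ z, U z ∈ Icc (0 : ℝ) 1) →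
                  ∀ μ : Fin n × Fin K → Measure X, (∀ j, IsProbabilityMeasure (μ j)) →
                  Measure.pi (fun j => (μ j) ⊗ₘ πref)
                      {z | ∃ r ∈ H, expectedUtility πref β U μ (learner (observe U z)) + ε <
                        expectedUtility πref β U μ r}
                    ≤ ENNReal.ofReal δ) := by
  -- `A` dominates `G + L * (|B| + 1)` for both observables, so one sample size serves both learning
  -- claims.
  obtain ⟨A, hA1, hA2⟩ : ∃ A : ℝ, Λ * |B| + 1 + Λ * (|B| + 1) ≤ A ∧
      Real.exp (B / β) ^ 2 + 2 * Real.exp (B / β) ^ 4 / β * (|B| + 1) ≤ A :=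
    ⟨_, le_max_left _ _, le_max_right _ _⟩
  refine ⟨(180 * A / δ) ^ 2 + 1, by positivity, fun N K d ε hN hK hε => ?_⟩
  obtain ⟨n₀, hNn, hle, heq, hn₀⟩ :=
    exists_sample_size (c := (180 * A / δ) ^ 2) (by positivity) N K d ε hN hK
  refine ⟨n₀, hNn, hle, heq, fun n hn X Y _ _ H hH hd => ?_⟩
  have hn0 : 0 < n := hN.trans_le (hNn.trans hn)
  have : Nonempty (Fin n × Fin K) := ⟨(⟨0, hn0⟩, ⟨0, hK⟩)⟩
  have hm : (180 * A / δ) ^ 2 * (d / ε ^ 2) ≤ Fintype.card (Fin n × Fin K) := by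
    rw [Fintype.card_prod, Fintype.card_fin, Fintype.card_fin]
    exact_mod_cast hn₀ n hn
  refine ⟨fun U hU _ D hD hatom => ae_isRanking_iff hU D hatom, fun ℓ hℓ => ?_, fun πref _ => ?_⟩
  · exact ⟨hℓ.exists_isApproxERM hH (half_pos hε), fun U hU hU1 D hD =>
      hℓ.measure_excess_loss_le hH hd hU hU1 D hε hδ hA1 hm⟩
  · exact hH.exists_policy_learner πref hd hβ hε hδ hA2 hm
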